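/- Let $k$ be a perfect field and let $A$ and $B$ be basic finite dimensional $k$-algebras, that is, $A/\operatorname{rad}A$ and $B/\operatorname{rad}B$ are finite products of division rings. Let $M$ be a finitely generated projective $B$-$A$-bimodule (i.e. a finitely generated projective left $B\otimes_k A^{\mathsf{op}}$-module) and let $N$ be a finitely generated projective $A$-$B$-bimodule. Let $m\ge 1$, and for an $A$-bimodule $Z$ let $H_0(A,Z)=Z/\langle az-za \mid a\in A,\ z\in Z\rangle$, where $\langle\ \rangle$ denotes the $k$-subspace generated. The cyclic group $C_m=\langle t\mid t^m=1\rangle$ acts on the space $H_0\left(A,(N\otimes_B M)^{\otimes_A m}\right)$ by cyclic permutation: $$t\,(y_m\otimes x_m\otimes\cdots\otimes y_2\otimes x_2\otimes y_1\otimes x_1)=y_1\otimes x_1\otimes y_m\otimes x_m\otimes\cdots\otimes y_2\otimes x_2\qquad (y_i\in N,\ x_i\in M).$$ If $H_0\left(A,(N\otimes_B M)^{\otimes_A m}\right)^{C_m}=0$, then $H_0\left(A,(N\otimes_B M)^{\otimes_A m}\right)=0$. -/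

import Mathlib

open scoped TensorProduct MulOpposite

universe u v w x y

/-- A (finite dimensional) algebra `A` is basic if the quotient of `A` by its Jacobson radical is
isomorphic to a finite product of division rings. -/
def IsBasicAlgebra (A : Type u) [Ring A] : Prop :=
  ∃ (r : ℕ) (D : Fin r → Type u) (_ : ∀ i, DivisionRing (D i)),
    Nonempty ((A ⧸ Ring.jacobson A) ≃+* (∀ i, D i))

/-- An `A`-`B`-bimodule `X` (with the same action of `k` on both sides) is finitely generated
projective if it is so as a left module over `A ⊗[k] Bᵐᵒᵖ`, where `(a ⊗ op b) x = a x b`. -/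
def IsFGProjectiveBimodule (k : Type u) [Field k] (A : Type v) [Ring A] [Algebra k A]
    (B : Type w) [Ring B] [Algebra k B]
    (X : Type x) [AddCommGroup X] [Module k X] [Module A X] [Module Bᵐᵒᵖ X]
    [IsScalarTower k A X] [IsScalarTower k Bᵐᵒᵖ X] [SMulCommClass A Bᵐᵒᵖ X] : Prop :=
  letI : Module (A ⊗[k] Bᵐᵒᵖ) X := TensorProduct.Algebra.module
  Module.Finite (A ⊗[k] Bᵐᵒᵖ) X ∧ Module.Projective (A ⊗[k] Bᵐᵒᵖ) X

namespace Bimod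

section Descend

variable {k : Type u} [Field k] {X : Type v} [AddCommGroup X] [Module k X]
  {R : Type w} [Ring R] [Algebra k R]

/-- A representation of an algebra `R` on `X` that preserves a subspace `S` acts on `X ⧸ S`. -/
noncomputable def descend (S : Submodule k X) (ρ : R →ₐ[k] Module.End k X)
    (h : ∀ a, S ≤ S.comap (ρ a)) : R →ₐ[k] Module.End k (X ⧸ S) :=
  AlgHom.ofLinearMap
    { toFun := fun a => S.mapQ S (ρ a) (h a)
      map_add' := fun a b => by ext; simp
      map_smul' := fun c a => by ext; simp }
    (by ext; simp)
    (fun a b => by ext; simp)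

@[simp] theorem descend_mk (S : Submodule k X) (ρ : R →ₐ[k] Module.End k X)
    (h : ∀ a, S ≤ S.comap (ρ a)) (a : R) (z : X) :
    descend S ρ h a (S.mkQ z) = S.mkQ (ρ a z) := rfl

end Descend

section BalancedTensor

variable (k : Type u) [Field k] (B : Type v) [Ring B]
  (N : Type w) [AddCommGroup N] [Module k N] [Module Bᵐᵒᵖ N]
  (M : Type x) [AddCommGroup M] [Module k M] [Module B M]

/-- The subspace of `N ⊗[k] M` generated by the elements `n b ⊗ m - n ⊗ b m`. -/
def balancedRel : Submodule k (N ⊗[k] M) :=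
  Submodule.span k {z | ∃ (n : N) (b : B) (m : M),
    z = (MulOpposite.op b • n) ⊗ₜ[k] m - n ⊗ₜ[k] (b • m)}

/-- The tensor product `N ⊗_B M` of a right `B`-module and a left `B`-module. -/
def BalancedTensor : Type (max w x) := (N ⊗[k] M) ⧸ balancedRel k B N M

noncomputable instance : AddCommGroup (BalancedTensor k B N M) :=
  inferInstanceAs (AddCommGroup ((N ⊗[k] M) ⧸ balancedRel k B N M))

noncomputable instance : Module k (BalancedTensor k B N M) :=
  inferInstanceAs (Module k ((N ⊗[k] M) ⧸ balancedRel k B N M))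

variable {N M} in
/-- The class of `n ⊗ m` in `N ⊗_B M`. -/
noncomputable def BalancedTensor.tmul (n : N) (m : M) : BalancedTensor k B N M :=
  (balancedRel k B N M).mkQ (n ⊗ₜ[k] m)

section Left

variable (A : Type y) [Ring A] [Algebra k A] [Module A N] [IsScalarTower k A N]
  [SMulCommClass A Bᵐᵒᵖ N]

/-- The left action of `A` on `N ⊗_B M` through `N`. -/
noncomputable def leftHom : A →ₐ[k] Module.End k (BalancedTensor k B N M) :=
  descend (balancedRel k B N M)
    ((Module.End.rTensorAlgHom k N M).comp (Algebra.lsmul k k N : A →ₐ[k] Module.End k N))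
    (fun a => by
      refine Submodule.span_le.2 ?_
      rintro _ ⟨n, b, m, rfl⟩
      refine Submodule.subset_span ⟨a • n, b, m, ?_⟩
      rw [← smul_comm a (MulOpposite.op b) n]
      exact map_sub _ _ _)

noncomputable instance (priority := low) : Module A (BalancedTensor k B N M) :=
  Module.compHom _ (leftHom k B N M A).toRingHom

theorem left_smul_tmul (a : A) (n : N) (m : M) :
    a • BalancedTensor.tmul k B n m = BalancedTensor.tmul k B (a • n) m := rfl

instance : IsScalarTower k A (BalancedTensor k B N M) where
  smul_assoc c a z := by
    change leftHom k B N M A (c • a) z = c • leftHom k B N M A a z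
    rw [map_smul, LinearMap.smul_apply]

end Left

section Right

variable (A : Type y) [Ring A] [Algebra k A] [Module Aᵐᵒᵖ M] [IsScalarTower k Aᵐᵒᵖ M]
  [SMulCommClass B Aᵐᵒᵖ M]

/-- The right action of `A` on `N ⊗_B M` through `M`. -/
noncomputable def rightHom : Aᵐᵒᵖ →ₐ[k] Module.End k (BalancedTensor k B N M) :=
  descend (balancedRel k B N M)
    ((Module.End.lTensorAlgHom k M N).comp (Algebra.lsmul k k M : Aᵐᵒᵖ →ₐ[k] Module.End k M))
    (fun a => by
      refine Submodule.span_le.2 ?_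
      rintro _ ⟨n, b, m, rfl⟩
      refine Submodule.subset_span ⟨n, b, a • m, ?_⟩
      rw [smul_comm b a m]
      exact map_sub _ _ _)

noncomputable instance (priority := low) : Module Aᵐᵒᵖ (BalancedTensor k B N M) :=
  Module.compHom _ (rightHom k B N M A).toRingHom

theorem right_smul_tmul (a : Aᵐᵒᵖ) (n : N) (m : M) :
    a • BalancedTensor.tmul k B n m = BalancedTensor.tmul k B n (a • m) := rfl

instance : IsScalarTower k Aᵐᵒᵖ (BalancedTensor k B N M) where
  smul_assoc c a z := by
    change rightHom k B N M A (c • a) z = c • rightHom k B N M A a z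
    rw [map_smul, LinearMap.smul_apply]

end Right

instance (A : Type y) [Ring A] [Algebra k A] [Module A N] [IsScalarTower k A N]
    [SMulCommClass A Bᵐᵒᵖ N] (A' : Type*) [Ring A'] [Algebra k A'] [Module A'ᵐᵒᵖ M]
    [IsScalarTower k A'ᵐᵒᵖ M] [SMulCommClass B A'ᵐᵒᵖ M] :
    SMulCommClass A A'ᵐᵒᵖ (BalancedTensor k B N M) where
  smul_comm a a' z := by
    have h : (leftHom k B N M A a).comp (rightHom k B N M A' a')
        = (rightHom k B N M A' a').comp (leftHom k B N M A a) := by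
      refine Submodule.linearMap_qext _ (TensorProduct.ext' fun n m => ?_)
      rfl
    exact LinearMap.congr_fun h z

end BalancedTensor

section TensorPower

variable (k : Type u) [Field k] (A : Type v) [Ring A] [Algebra k A]
  (P : Type w) [AddCommGroup P] [Module k P] [Module A P] [Module Aᵐᵒᵖ P]

/-- The subspace of the `(n+1)`-fold tensor power `P ⊗_k ⋯ ⊗_k P` generated by the elements
`p₀ ⊗ ⋯ ⊗ pᵢ a ⊗ pᵢ₊₁ ⊗ ⋯ ⊗ pₙ - p₀ ⊗ ⋯ ⊗ pᵢ ⊗ a pᵢ₊₁ ⊗ ⋯ ⊗ pₙ`. -/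
def powRel (n : ℕ) : Submodule k (⨂[k] _ : Fin (n + 1), P) :=
  Submodule.span k {z | ∃ (p : Fin (n + 1) → P) (i : Fin n) (a : A),
    z = PiTensorProduct.tprod k
          (Function.update p i.castSucc (MulOpposite.op a • p i.castSucc))
        - PiTensorProduct.tprod k (Function.update p i.succ (a • p i.succ))}

/-- The tensor power `P ⊗_A ⋯ ⊗_A P` of an `A`-bimodule `P`, with `n + 1` factors. -/
def TensorPow (n : ℕ) : Type (max u w) := (⨂[k] _ : Fin (n + 1), P) ⧸ powRel k A P n

noncomputable instance (n : ℕ) : AddCommGroup (TensorPow k A P n) :=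
  inferInstanceAs (AddCommGroup ((⨂[k] _ : Fin (n + 1), P) ⧸ powRel k A P n))

noncomputable instance (n : ℕ) : Module k (TensorPow k A P n) :=
  inferInstanceAs (Module k ((⨂[k] _ : Fin (n + 1), P) ⧸ powRel k A P n))

variable {P} in
/-- The class of `p₀ ⊗ p₁ ⊗ ⋯ ⊗ pₙ` in `P ⊗_A ⋯ ⊗_A P`. -/
noncomputable def TensorPow.tprod {n : ℕ} (p : Fin (n + 1) → P) : TensorPow k A P n :=
  (powRel k A P n).mkQ (PiTensorProduct.tprod k p)

/-- The linear map sending an endomorphism `f` of `P` to `id ⊗ ⋯ ⊗ f ⊗ ⋯ ⊗ id`, with `f` acting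
on the factor at position `i`. -/
noncomputable def atFactorLin {n : ℕ} (i : Fin n) :
    Module.End k P →ₗ[k] Module.End k (⨂[k] _ : Fin n, P) where
  toFun f := PiTensorProduct.map (Function.update (fun _ => LinearMap.id) i f)
  map_add' f g := PiTensorProduct.map_update_add (fun _ : Fin n => (LinearMap.id : P →ₗ[k] P)) i f g
  map_smul' c f := PiTensorProduct.map_update_smul (fun _ : Fin n => (LinearMap.id : P →ₗ[k] P)) i c f

theorem atFactorLin_tprod {n : ℕ} (i : Fin n) (f : Module.End k P) (p : Fin n → P) :
    atFactorLin k P i f (PiTensorProduct.tprod k p)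
      = PiTensorProduct.tprod k (Function.update p i (f (p i))) := by
  change PiTensorProduct.map _ _ = _
  rw [PiTensorProduct.map_tprod]
  congr 1
  funext j
  by_cases hj : j = i
  · subst hj; simp
  · simp [hj]

/-- The map `f ↦ id ⊗ ⋯ ⊗ f ⊗ ⋯ ⊗ id` as a morphism of algebras. -/
noncomputable def atFactor {n : ℕ} (i : Fin n) :
    Module.End k P →ₐ[k] Module.End k (⨂[k] _ : Fin n, P) :=
  AlgHom.ofLinearMap (atFactorLin k P i)
    (by
      refine PiTensorProduct.ext (MultilinearMap.ext fun p => ?_)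
      exact (atFactorLin_tprod k P i 1 p).trans
        (congrArg (PiTensorProduct.tprod k) (Function.update_eq_self i p)))
    (fun f g => by
      refine PiTensorProduct.ext (MultilinearMap.ext fun p => ?_)
      change atFactorLin k P i (f * g) (PiTensorProduct.tprod k p)
        = atFactorLin k P i f (atFactorLin k P i g (PiTensorProduct.tprod k p))
      rw [atFactorLin_tprod, atFactorLin_tprod, atFactorLin_tprod]
      simp)

theorem atFactor_tprod {n : ℕ} (i : Fin n) (f : Module.End k P) (p : Fin n → P) :
    atFactor k P i f (PiTensorProduct.tprod k p)
      = PiTensorProduct.tprod k (Function.update p i (f (p i))) :=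
  atFactorLin_tprod k P i f p

variable [IsScalarTower k A P] [IsScalarTower k Aᵐᵒᵖ P] [SMulCommClass A Aᵐᵒᵖ P]

theorem powRel_le_left (n : ℕ) (a : A) : powRel k A P n ≤ (powRel k A P n).comap
    (((atFactor k P (0 : Fin (n + 1))).comp (Algebra.lsmul k k P : A →ₐ[k] Module.End k P)) a) := by
  refine Submodule.span_le.2 ?_
  rintro _ ⟨p, i, b, rfl⟩
  refine Submodule.subset_span ⟨Function.update p 0 (a • p 0), i, b, ?_⟩
  change atFactor k P 0 _ _ = _
  rw [map_sub, atFactor_tprod, atFactor_tprod]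
  have hs : i.succ ≠ 0 := Fin.succ_ne_zero i
  congr 2
  · by_cases h : i.castSucc = 0
    · rw [h]; simp [smul_comm a (MulOpposite.op b) (p 0)]
    · rw [Function.update_comm h, Function.update_of_ne (Ne.symm h), Function.update_of_ne h]
      rfl
  · rw [Function.update_comm hs, Function.update_of_ne (Ne.symm hs), Function.update_of_ne hs]
    rfl

theorem powRel_le_right (n : ℕ) (a : Aᵐᵒᵖ) : powRel k A P n ≤ (powRel k A P n).comap
    (((atFactor k P (Fin.last n)).comp
      (Algebra.lsmul k k P : Aᵐᵒᵖ →ₐ[k] Module.End k P)) a) := by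
  refine Submodule.span_le.2 ?_
  rintro _ ⟨p, i, b, rfl⟩
  refine Submodule.subset_span
    ⟨Function.update p (Fin.last n) (a • p (Fin.last n)), i, b, ?_⟩
  change atFactor k P (Fin.last n) _ _ = _
  rw [map_sub, atFactor_tprod, atFactor_tprod]
  have hs : i.castSucc ≠ Fin.last n := (Fin.castSucc_lt_last i).ne
  congr 2
  · rw [Function.update_comm hs, Function.update_of_ne (Ne.symm hs), Function.update_of_ne hs]
    rfl
  · by_cases h : i.succ = Fin.last n
    · rw [h]; simp [smul_comm b a (p (Fin.last n))]
    · rw [Function.update_comm h, Function.update_of_ne (Ne.symm h), Function.update_of_ne h]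
      rfl

/-- The left action of `A` on `P ⊗_A ⋯ ⊗_A P` through the first factor. -/
noncomputable def powLeftHom (n : ℕ) : A →ₐ[k] Module.End k (TensorPow k A P n) :=
  descend (powRel k A P n)
    ((atFactor k P (0 : Fin (n + 1))).comp (Algebra.lsmul k k P : A →ₐ[k] Module.End k P))
    (powRel_le_left k A P n)

/-- The right action of `A` on `P ⊗_A ⋯ ⊗_A P` through the last factor. -/
noncomputable def powRightHom (n : ℕ) : Aᵐᵒᵖ →ₐ[k] Module.End k (TensorPow k A P n) :=
  descend (powRel k A P n)
    ((atFactor k P (Fin.last n)).comp (Algebra.lsmul k k P : Aᵐᵒᵖ →ₐ[k] Module.End k P))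
    (powRel_le_right k A P n)

noncomputable instance (priority := low) (n : ℕ) : Module A (TensorPow k A P n) :=
  Module.compHom _ (powLeftHom k A P n).toRingHom

noncomputable instance (priority := low) (n : ℕ) : Module Aᵐᵒᵖ (TensorPow k A P n) :=
  Module.compHom _ (powRightHom k A P n).toRingHom

theorem smul_tprod (n : ℕ) (a : A) (p : Fin (n + 1) → P) :
    a • TensorPow.tprod k A p = TensorPow.tprod k A (Function.update p 0 (a • p 0)) :=
  congrArg (powRel k A P n).mkQ (atFactor_tprod k P 0 _ p)

theorem op_smul_tprod (n : ℕ) (a : Aᵐᵒᵖ) (p : Fin (n + 1) → P) :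
    a • TensorPow.tprod k A p
      = TensorPow.tprod k A (Function.update p (Fin.last n) (a • p (Fin.last n))) :=
  congrArg (powRel k A P n).mkQ (atFactor_tprod k P (Fin.last n) _ p)

instance (n : ℕ) : IsScalarTower k A (TensorPow k A P n) where
  smul_assoc c a z := by
    change powLeftHom k A P n (c • a) z = c • powLeftHom k A P n a z
    rw [map_smul, LinearMap.smul_apply]

instance (n : ℕ) : IsScalarTower k Aᵐᵒᵖ (TensorPow k A P n) where
  smul_assoc c a z := by
    change powRightHom k A P n (c • a) z = c • powRightHom k A P n a z
    rw [map_smul, LinearMap.smul_apply]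

variable {k A P} in
theorem tensorPow_ext {n : ℕ} {Z : Type*} [AddCommGroup Z] [Module k Z]
    {f g : TensorPow k A P n →ₗ[k] Z}
    (h : ∀ p : Fin (n + 1) → P, f (TensorPow.tprod k A p) = g (TensorPow.tprod k A p)) : f = g :=
  Submodule.linearMap_qext _ (PiTensorProduct.ext (MultilinearMap.ext h))

instance (n : ℕ) : SMulCommClass A Aᵐᵒᵖ (TensorPow k A P n) where
  smul_comm a b z := by
    have h : (powLeftHom k A P n a).comp (powRightHom k A P n b)
        = (powRightHom k A P n b).comp (powLeftHom k A P n a) := by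
      refine tensorPow_ext fun p => ?_
      change a • b • TensorPow.tprod k A p = b • a • TensorPow.tprod k A p
      rw [op_smul_tprod, smul_tprod, smul_tprod, op_smul_tprod]
      congr 1
      by_cases h0 : (0 : Fin (n + 1)) = Fin.last n
      · rw [← h0]; simp [smul_comm a b]
      · rw [Function.update_comm h0, Function.update_of_ne h0,
          Function.update_of_ne (Ne.symm h0)]
    exact LinearMap.congr_fun h z

end TensorPower

section Hochschild

variable (k : Type u) [Field k] (A : Type v) [Ring A]
  (Z : Type w) [AddCommGroup Z] [Module k Z] [Module A Z] [Module Aᵐᵒᵖ Z]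

/-- The subspace of a bimodule `Z` generated by the elements `a z - z a`. -/
def commutators : Submodule k Z :=
  Submodule.span k {z | ∃ (a : A) (y : Z), z = a • y - MulOpposite.op a • y}

/-- Hochschild homology in degree zero, `H₀(A, Z) = Z / ⟨a z - z a⟩`. -/
abbrev H0 : Type w := Z ⧸ commutators k A Z

end Hochschild

section Cyclic

variable (k : Type u) [Field k] (A : Type v) [Ring A] [Algebra k A]
  (P : Type w) [AddCommGroup P] [Module k P] [Module A P] [Module Aᵐᵒᵖ P]
  [IsScalarTower k A P] [IsScalarTower k Aᵐᵒᵖ P] [SMulCommClass A Aᵐᵒᵖ P]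

variable {P} in
/-- The class of `p₀ ⊗ p₁ ⊗ ⋯ ⊗ pₙ` in `H₀(A, P ⊗_A ⋯ ⊗_A P)`. -/
noncomputable def cls {n : ℕ} (p : Fin (n + 1) → P) : H0 k A (TensorPow k A P n) :=
  (commutators k A (TensorPow k A P n)).mkQ (TensorPow.tprod k A p)

theorem cls_balanced {n : ℕ} (p : Fin (n + 1) → P) (i : Fin n) (a : A) :
    cls k A (Function.update p i.castSucc (MulOpposite.op a • p i.castSucc))
      = cls k A (Function.update p i.succ (a • p i.succ)) := by
  refine congrArg (commutators k A (TensorPow k A P n)).mkQ ?_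
  exact (Submodule.Quotient.eq _).2 (Submodule.subset_span ⟨p, i, a, rfl⟩)

theorem cls_comm {n : ℕ} (p : Fin (n + 1) → P) (a : A) :
    cls k A (Function.update p 0 (a • p 0))
      = cls k A (Function.update p (Fin.last n) (MulOpposite.op a • p (Fin.last n))) := by
  refine (Submodule.Quotient.eq _).2 (Submodule.subset_span ⟨a, TensorPow.tprod k A p, ?_⟩)
  rw [smul_tprod, op_smul_tprod]

/-- The relations above, indexed cyclically. -/
theorem cls_cyclic {n : ℕ} (p : Fin (n + 1) → P) (j : Fin (n + 1)) (a : A) :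
    cls k A (Function.update p j (MulOpposite.op a • p j))
      = cls k A (Function.update p (finRotate (n + 1) j) (a • p (finRotate (n + 1) j))) := by
  induction j using Fin.lastCases with
  | last => rw [finRotate_last]; exact (cls_comm k A P p a).symm
  | cast i =>
    have h : finRotate (n + 1) i.castSucc = i.succ := by
      rw [finRotate_apply]; simp
    rw [h]; exact cls_balanced k A P p i a

theorem update_rotate {n : ℕ} (p : Fin (n + 1) → P) (j : Fin (n + 1)) (q : P) :
    (fun i => Function.update p j q ((finRotate (n + 1)).symm i))
      = Function.update (fun i => p ((finRotate (n + 1)).symm i)) (finRotate (n + 1) j) q := by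
  funext i
  by_cases h : i = finRotate (n + 1) j
  · subst h; simp
  · rw [Function.update_of_ne h, Function.update_of_ne]
    intro h'
    exact h (by rw [← h', Equiv.apply_symm_apply])

/-- The cyclic permutation, from the tensor power over `k` to `H₀(A, P ⊗_A ⋯ ⊗_A P)`. -/
noncomputable def rotate₀ (n : ℕ) :
    (⨂[k] _ : Fin (n + 1), P) →ₗ[k] H0 k A (TensorPow k A P n) :=
  (commutators k A (TensorPow k A P n)).mkQ ∘ₗ (powRel k A P n).mkQ ∘ₗ
    (PiTensorProduct.reindex k (fun _ : Fin (n + 1) => P) (finRotate (n + 1))).toLinearMap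

theorem rotate₀_tprod {n : ℕ} (p : Fin (n + 1) → P) :
    rotate₀ k A P n (PiTensorProduct.tprod k p)
      = cls k A (fun i => p ((finRotate (n + 1)).symm i)) :=
  congrArg (fun z => (commutators k A (TensorPow k A P n)).mkQ ((powRel k A P n).mkQ z))
    (PiTensorProduct.reindex_tprod (finRotate (n + 1)) p)

theorem powRel_le_ker (n : ℕ) : powRel k A P n ≤ LinearMap.ker (rotate₀ k A P n) := by
  refine Submodule.span_le.2 ?_
  rintro _ ⟨p, i, a, rfl⟩
  rw [SetLike.mem_coe, LinearMap.mem_ker, map_sub, sub_eq_zero, rotate₀_tprod, rotate₀_tprod,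
    update_rotate, update_rotate]
  have h : finRotate (n + 1) i.castSucc = i.succ := by
    rw [finRotate_apply]; simp
  have key := cls_cyclic k A P (fun j => p ((finRotate (n + 1)).symm j))
    (finRotate (n + 1) i.castSucc) a
  rw [Equiv.symm_apply_apply, Equiv.symm_apply_apply] at key
  rw [key, h]

/-- The cyclic permutation, from `P ⊗_A ⋯ ⊗_A P` to `H₀(A, P ⊗_A ⋯ ⊗_A P)`. -/
noncomputable def rotate₁ (n : ℕ) :
    TensorPow k A P n →ₗ[k] H0 k A (TensorPow k A P n) :=
  (powRel k A P n).liftQ (rotate₀ k A P n) (powRel_le_ker k A P n)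

theorem rotate₁_tprod {n : ℕ} (p : Fin (n + 1) → P) :
    rotate₁ k A P n (TensorPow.tprod k A p)
      = cls k A (fun i => p ((finRotate (n + 1)).symm i)) :=
  rotate₀_tprod k A P p

theorem commutators_le_ker (n : ℕ) :
    commutators k A (TensorPow k A P n) ≤ LinearMap.ker (rotate₁ k A P n) := by
  refine Submodule.span_le.2 ?_
  rintro _ ⟨a, z, rfl⟩
  rw [SetLike.mem_coe, LinearMap.mem_ker, map_sub, sub_eq_zero]
  have h : (rotate₁ k A P n).comp (powLeftHom k A P n a)
      = (rotate₁ k A P n).comp (powRightHom k A P n (MulOpposite.op a)) := by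
    refine tensorPow_ext fun p => ?_
    change rotate₁ k A P n (a • TensorPow.tprod k A p)
      = rotate₁ k A P n (MulOpposite.op a • TensorPow.tprod k A p)
    rw [smul_tprod, op_smul_tprod, rotate₁_tprod, rotate₁_tprod, update_rotate, update_rotate]
    have key := cls_cyclic k A P (fun j => p ((finRotate (n + 1)).symm j))
      (finRotate (n + 1) (Fin.last n)) a
    rw [Equiv.symm_apply_apply, Equiv.symm_apply_apply] at key
    rw [key, finRotate_last]
  exact LinearMap.congr_fun h z

/-- The operator `t` on `H₀(A, P ⊗_A ⋯ ⊗_A P)` that moves the last factor to the front: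
`t (p₀ ⊗ p₁ ⊗ ⋯ ⊗ pₙ) = pₙ ⊗ p₀ ⊗ ⋯ ⊗ pₙ₋₁`. -/
noncomputable def rotate (n : ℕ) : Module.End k (H0 k A (TensorPow k A P n)) :=
  (commutators k A (TensorPow k A P n)).liftQ (rotate₁ k A P n) (commutators_le_ker k A P n)

theorem rotate_cls {n : ℕ} (p : Fin (n + 1) → P) :
    rotate k A P n (cls k A p) = cls k A (fun i => p ((finRotate (n + 1)).symm i)) :=
  rotate₁_tprod k A P p

theorem rotate_pow_cls {n : ℕ} (p : Fin (n + 1) → P) (j : ℕ) :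
    (rotate k A P n ^ j) (cls k A p)
      = cls k A (fun i => p (((finRotate (n + 1)) ^ j).symm i)) := by
  induction j with
  | zero => rfl
  | succ j ih =>
    rw [pow_succ', Module.End.mul_apply, ih, rotate_cls]
    congr 1

theorem rotate_pow_card (n : ℕ) : rotate k A P n ^ (n + 1) = 1 := by
  refine Submodule.linearMap_qext _ (tensorPow_ext fun p => ?_)
  change (rotate k A P n ^ (n + 1)) (cls k A p) = cls k A p
  rw [rotate_pow_cls]
  have h : finRotate (n + 1) ^ (n + 1) = 1 := by
    have hj : ∀ (j : ℕ) (i : Fin (n + 1)),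
        ((finRotate (n + 1) ^ j) i : ℕ) = ((i : ℕ) + j) % (n + 1) := by
      intro j i
      induction j with
      | zero => simp [Nat.mod_eq_of_lt i.isLt]
      | succ j ih =>
        rw [pow_succ', Equiv.Perm.mul_apply, finRotate_apply, Fin.val_add, ih, Fin.val_one',
          ← Nat.add_mod, add_assoc]
    refine Equiv.ext fun i => Fin.ext ?_
    rw [hj, Nat.add_mod_right, Nat.mod_eq_of_lt i.isLt]
    rfl
  rw [h]
  rfl

/-- The action of the cyclic group `C_{n+1} = ⟨t⟩` of order `n + 1` on
`H₀(A, P ⊗_A ⋯ ⊗_A P)` (with `n + 1` factors) for which `t` acts by the cyclic permutation. -/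
noncomputable def cyclicRep (n : ℕ) :
    Representation k (Multiplicative (ZMod (n + 1))) (H0 k A (TensorPow k A P n)) where
  toFun g := rotate k A P n ^ (Multiplicative.toAdd g).val
  map_one' := by simp
  map_mul' g h := by
    rw [toAdd_mul, ZMod.val_add, ← pow_add]
    exact (pow_eq_pow_mod _ (rotate_pow_card k A P n)).symm

end Cyclic

end Bimod

/-! Write `P = N ⊗_B M` and let `t` be the cyclic permutation of `H₀(A, P ⊗_A ⋯ ⊗_A P)`. This space
is finite dimensional, so if `t - 1` is injective it is surjective, and every functional `F` with `F
∘ t = F` is zero. It therefore suffices to build a nonzero `t`-invariant functional whenever `H₀ ≠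
0`; its values may lie in the algebraic closure `K` of `k`. No averaging over the group occurs, so
the characteristic does not matter.

The functionals come from trace forms. For functionals `ℓ₀, …, ℓₙ` on `A`, the form `∏ ℓₛ (bₛ
aₛ₊₁)`, with indices read cyclically, is multilinear in the tensors `aₛ ⊗ bₛ` of the enveloping
algebra and respects the relations that define `H₀`. It is cyclically symmetric when all `ℓₛ`
coincide. Since `P` is finitely generated projective over `A ⊗ Aᵐᵒᵖ` (`DualBasis.tensor`), every
functional on `H₀` is a combination of trace forms evaluated on coordinates. Hence `H₀ ≠ 0` makes
some trace form nonzero on coordinates (`DualBasis.exists_traceForm_ne_zero`), but with functionals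
and coordinates that vary with the position.

The symmetrization is `exists_traceForm_ne_zero`. Over `K` the projective bimodule is a sum of
modules generated by idempotents `eᵢ ⊗ eⱼ` with local corners. A nonzero trace form yields a cyclic
chain of summands `(iₛ, jₛ)` with every `e_{jₛ} A e_{iₛ₊₁}` nonzero. One functional `ℓ` can be
chosen nonzero on a fixed element of each nonzero `eⱼ A eᵢ`, and one bimodule map `Ψ`, the sum of
all projections, sees every summand. The form `∏ ℓ` applied to `Ψ` at every position is then
symmetric and nonzero on the chain. Because the `k`-rational tensors span over `K`, it is already
nonzero on elements of `P` (`exists_traceForm_envelopingMap_ne_zero`). -/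

/-- A multilinear map vanishing on tuples from given sets vanishes on tuples from their spans. -/
theorem MultilinearMap.eq_zero_of_mem_span {R ι : Type*} {M : ι → Type*} {Z : Type*} [Finite ι]
    [CommSemiring R] [∀ i, AddCommMonoid (M i)] [∀ i, Module R (M i)] [AddCommMonoid Z] [Module R Z]
    (f : MultilinearMap R M Z) (S : ∀ i, Set (M i)) (hf : ∀ m, (∀ i, m i ∈ S i) → f m = 0)
    (m : ∀ i, M i) (hm : ∀ i, m i ∈ Submodule.span R (S i)) : f m = 0 := by
  classical
  have := Fintype.ofFinite ι
  -- The set `s` records the positions already relaxed from generators to arbitrary elements of the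
  -- span.
  suffices H : ∀ (s : Finset ι) (m : ∀ i, M i), (∀ i ∈ s, m i ∈ Submodule.span R (S i)) →
      (∀ i ∉ s, m i ∈ S i) → f m = 0 from H Finset.univ m (fun i _ => hm i) (by simp)
  intro s
  induction s using Finset.induction_on with
  | empty => intro m _ h; exact hf m fun i => h i (by simp)
  | insert a s ha ih =>
    intro m h1 h2
    have key : ∀ z ∈ Submodule.span R (S a), f (Function.update m a z) = 0 := by
      intro z hz
      induction hz using Submodule.span_induction with
      | mem z hz =>
        refine ih _ (fun i hi => ?_) (fun i hi => ?_)
        · have hia : i ≠ a := fun h => ha (h ▸ hi)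
          rw [Function.update_of_ne hia]
          exact h1 i (Finset.mem_insert_of_mem hi)
        · by_cases hia : i = a
          · subst hia; simpa using hz
          · rw [Function.update_of_ne hia]
            exact h2 i (by simp [hia, hi])
      | zero => exact f.map_update_zero m a
      | add z z' _ _ hz hz' => rw [f.map_update_add, hz, hz', add_zero]
      | smul c z _ hz => rw [f.map_update_smul, hz, smul_zero]
    simpa using key (m a) (h1 a (Finset.mem_insert_self _ _))

/-! ### Trace forms on the enveloping algebra -/

section TraceForm

variable {K : Type u} [Field K] {A : Type v} [Ring A] [Algebra K A]

/-- The bimodule map `x ⊗ y ↦ (v ↦ ℓ (y v) x)` from `A ⊗ Aᵐᵒᵖ` to the endomorphisms of `A`. -/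
noncomputable def rankOneMap (ℓ : Module.Dual K A) : A ⊗[K] Aᵐᵒᵖ →ₗ[K] Module.End K A :=
  TensorProduct.lift (LinearMap.mk₂ K
    (fun (x : A) (y : Aᵐᵒᵖ) => (ℓ ∘ₗ LinearMap.mulLeft K y.unop).smulRight x)
    (fun x x' y => by ext; simp) (fun c x y => by ext; simp [mul_comm, smul_smul])
    (fun x y y' => by ext; simp [add_mul, add_smul]) (fun c x y => by ext; simp [smul_smul]))

theorem rankOneMap_tmul_apply (ℓ : Module.Dual K A) (x y v : A) :
    rankOneMap ℓ (x ⊗ₜ MulOpposite.op y) v = ℓ (y * v) • x := rfl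

/-- The multilinear form `(eᵢ) ↦ tr (∏ rankOneMap ℓᵢ eᵢ)`. -/
noncomputable def traceForm {n : ℕ} (ℓ : Fin (n + 1) → Module.Dual K A) :
    MultilinearMap K (fun _ : Fin (n + 1) => A ⊗[K] Aᵐᵒᵖ) K :=
  (LinearMap.trace K A).compMultilinearMap
    ((MultilinearMap.mkPiAlgebraFin K (n + 1) (Module.End K A)).compLinearMap
      fun i => rankOneMap (ℓ i))

/-- A product of rank-one operators has rank at most one: each functional is evaluated on the next
vector, leaving the first vector and the last functional. Taking the trace then closes the chain
into a cycle. -/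
theorem prod_rankOneMap_tmul_apply {n : ℕ} (ℓ : Fin (n + 1) → Module.Dual K A)
    (a b : Fin (n + 1) → A) (v : A) :
    (List.ofFn fun i => rankOneMap (ℓ i) (a i ⊗ₜ MulOpposite.op (b i))).prod v =
      ((∏ i : Fin n, ℓ i.castSucc (b i.castSucc * a i.succ)) *
        ℓ (Fin.last n) (b (Fin.last n) * v)) • a 0 := by
  induction n with
  | zero => simp [rankOneMap_tmul_apply]
  | succ n ih =>
    rw [List.ofFn_succ, List.prod_cons, Module.End.mul_apply,
      ih (fun i => ℓ i.succ) (fun i => a i.succ) (fun i => b i.succ), map_smul,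
      rankOneMap_tmul_apply, smul_smul, Fin.prod_univ_succ]
    congr 1
    simp only [Fin.succ_last, Fin.castSucc_zero, Fin.succ_castSucc]
    ring

/-- This is the formula that motivates the trace: multilinearity comes for free from the definition,
and the addition `i + 1` in `Fin (n + 1)` wraps around. -/
theorem traceForm_tmul [FiniteDimensional K A] {n : ℕ} (ℓ : Fin (n + 1) → Module.Dual K A)
    (a b : Fin (n + 1) → A) :
    traceForm ℓ (fun i => a i ⊗ₜ MulOpposite.op (b i)) = ∏ i, ℓ i (b i * a (i + 1)) := by
  have h : (List.ofFn fun i => rankOneMap (ℓ i) (a i ⊗ₜ MulOpposite.op (b i))).prod =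
      ((∏ i : Fin n, ℓ i.castSucc (b i.castSucc * a i.succ)) •
        (ℓ (Fin.last n) ∘ₗ LinearMap.mulLeft K (b (Fin.last n)))).smulRight (a 0) := by
    ext v
    rw [prod_rankOneMap_tmul_apply]
    simp
  change LinearMap.trace K A _ = _
  rw [MultilinearMap.compLinearMap_apply, MultilinearMap.mkPiAlgebraFin_apply, h]
  rw [LinearMap.trace_smulRight, Fin.prod_univ_castSucc]
  simp

theorem tmul_span_top :
    Submodule.span K {z : A ⊗[K] Aᵐᵒᵖ | ∃ a b : A, z = a ⊗ₜ MulOpposite.op b} = ⊤ := by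
  rw [← TensorProduct.span_tmul_eq_top]
  congr 1
  ext z
  constructor
  · rintro ⟨a, b, rfl⟩; exact ⟨a, _, rfl⟩
  · rintro ⟨a, b, rfl⟩; exact ⟨a, b.unop, rfl⟩

/-- Multilinear maps on `A ⊗ Aᵐᵒᵖ` are determined by their values on pure tensors. -/
theorem multilinear_ext_tmul {ι Z : Type*} [Finite ι] [AddCommGroup Z] [Module K Z]
    {f g : MultilinearMap K (fun _ : ι => A ⊗[K] Aᵐᵒᵖ) Z}
    (h : ∀ a b : ι → A, f (fun i => a i ⊗ₜ MulOpposite.op (b i)) =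
      g (fun i => a i ⊗ₜ MulOpposite.op (b i))) : f = g := by
  ext m
  rw [← sub_eq_zero, ← sub_apply]
  refine (f - g).eq_zero_of_mem_span (fun _ => {z | ∃ a b : A, z = a ⊗ₜ MulOpposite.op b}) ?_ m
    fun i => by rw [tmul_span_top]; trivial
  intro m hm
  choose a b hab using hm
  obtain rfl : m = fun i => a i ⊗ₜ MulOpposite.op (b i) := funext hab
  rw [sub_apply, h, sub_self]

end TraceForm

/-- Up to the scalar `c`, `z` equals `ε` times a unit of the form `1 +` nilpotent, so the inverse of
that unit, cut by `ε`, serves as a right inverse of `z` relative to `ε`. -/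
theorem exists_mul_eq_of_isNilpotent_sub {K R : Type*} [Field K] [Ring R] [Algebra K R] {ε z : R}
    (hε : IsIdempotentElem ε) (h1 : ε * z = z) {c : K} (hc : c ≠ 0)
    (h : IsNilpotent (z - c • ε)) : ∃ v, v * ε = v ∧ z * v = ε := by
  have hn : IsNilpotent (c⁻¹ • (z - c • ε)) := h.smul _
  obtain ⟨a, ha⟩ := hn.isUnit_one_add
  have hz : z = c • (ε * a) := by
    rw [ha, mul_add, mul_one, mul_smul_comm, mul_sub, mul_smul_comm, hε.eq, h1, smul_add,
      smul_smul, mul_inv_cancel₀ hc, one_smul]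
    abel
  refine ⟨c⁻¹ • ((a⁻¹ : Rˣ) * ε), ?_, ?_⟩
  · rw [smul_mul_assoc, mul_assoc, hε.eq]
  · rw [hz, smul_mul_smul_comm, mul_inv_cancel₀ hc, one_smul, mul_assoc, Units.mul_inv_cancel_left,
      hε.eq]

/-! ### Projective modules over an algebra with local idempotents -/

section Decomposition

variable {K R : Type*} [Field K] [Ring R] [Algebra K R] {ι : Type*} [Fintype ι] {ε : ι → R}

/-- A nonzero finitely generated projective module maps onto one of the projectives `R εᵢ`. -/
theorem exists_apply_eq_idempotent (hε : ∀ i, IsIdempotentElem (ε i)) (hsum : ∑ i, ε i = 1)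
    (hloc : ∀ i z, ∃ c : K, IsNilpotent (ε i * z * ε i - c • ε i))
    (Q : Type*) [AddCommGroup Q] [Module R Q] [Module.Finite R Q] [Module.Projective R Q]
    [Nontrivial Q] :
    ∃ (i : ι) (q : Q) (φ : Q →ₗ[R] R), q ≠ 0 ∧ ε i • q = q ∧ φ q = ε i ∧ ∀ z, φ z * ε i = φ z := by
  obtain ⟨m, hm⟩ := IsCoatomic.exists_coatom (Submodule R Q)
  have hs : IsSimpleModule R (Q ⧸ m) := isSimpleModule_iff_isCoatom.2 hm
  have := hs.nontrivial
  obtain ⟨ℓ, hℓ⟩ := exists_ne (0 : Q ⧸ m)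
  obtain ⟨q₀, rfl⟩ := m.mkQ_surjective ℓ
  obtain ⟨i, hi⟩ : ∃ i, ε i • m.mkQ q₀ ≠ 0 := by
    by_contra! h
    apply hℓ
    rw [← one_smul R (m.mkQ q₀), ← hsum, Finset.sum_smul]
    exact Finset.sum_eq_zero fun i _ => h i
  set ℓ := ε i • m.mkQ q₀ with hℓdef
  -- The simple quotient is generated by `ℓ`, and projectivity of `Q` lifts the quotient map through
  -- `R → Q ⧸ m` to `g : Q → R`.
  have hπ : Function.Surjective (LinearMap.toSpanSingleton R (Q ⧸ m) ℓ) := by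
    refine LinearMap.surjective_of_ne_zero fun h => hi ?_
    simpa using LinearMap.congr_fun h 1
  obtain ⟨g, hg⟩ := Module.projective_lifting_property _ m.mkQ hπ
  have hg' : ∀ z, g z • ℓ = m.mkQ z := fun z => LinearMap.congr_fun hg z
  have hεℓ : ε i • ℓ = ℓ := by rw [hℓdef, smul_smul, (hε i).eq]
  obtain ⟨c, hc⟩ := hloc i (g q₀)
  have hy : (ε i * g q₀ * ε i) • ℓ = ℓ := by
    rw [mul_smul, mul_smul, hεℓ, hg']
  -- The element `εᵢ g(q₀) εᵢ` fixes the nonzero vector `ℓ`, so it is not nilpotent.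
  have hc0 : c ≠ 0 := by
    rintro rfl
    rw [zero_smul, sub_zero] at hc
    obtain ⟨N, hN⟩ := hc
    have : ∀ N : ℕ, (ε i * g q₀ * ε i) ^ N • ℓ = ℓ := by
      intro N
      induction N with
      | zero => simp
      | succ N ih => rw [pow_succ, mul_smul, hy, ih]
    apply hi
    rw [← this N, hN, zero_smul]
  obtain ⟨v, hv1, hv2⟩ := exists_mul_eq_of_isNilpotent_sub (hε i)
    (by simp only [← mul_assoc, (hε i).eq]) hc0 hc
  refine ⟨i, ε i • q₀, (LinearMap.toSpanSingleton R R (ε i * v)) ∘ₗ g, fun h => ?_, ?_, ?_, ?_⟩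
  · apply hi
    rw [hℓdef, ← map_smul, h, map_zero]
  · rw [smul_smul, (hε i).eq]
  · simp only [LinearMap.comp_apply, map_smul, LinearMap.toSpanSingleton_apply, smul_eq_mul]
    simpa only [mul_assoc] using hv2
  · intro z
    simp only [LinearMap.comp_apply, LinearMap.toSpanSingleton_apply, smul_eq_mul, mul_assoc, hv1]

/-- A finitely generated projective module is a direct sum of modules of the form `R εᵢ`, here
expressed through the generators of the summands and the projections to them. -/
theorem exists_decomposition (hε : ∀ i, IsIdempotentElem (ε i)) (hsum : ∑ i, ε i = 1)
    (hloc : ∀ i z, ∃ c : K, IsNilpotent (ε i * z * ε i - c • ε i))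
    (Q : Type*) [AddCommGroup Q] [Module K Q] [Module R Q] [IsScalarTower K R Q]
    [FiniteDimensional K Q] [Module.Projective R Q] :
    ∃ (r : ℕ) (σ : Fin r → ι) (q : Fin r → Q) (φ : Fin r → Q →ₗ[R] R),
      (∀ α β, φ β (q α) = if α = β then ε (σ α) else 0) ∧ ∀ z, z = ∑ α, φ α z • q α := by
  induction hd : Module.finrank K Q using Nat.strong_induction_on generalizing Q with
  | _ d ih =>
  rcases subsingleton_or_nontrivial Q with h | h
  · exact ⟨0, Fin.elim0, Fin.elim0, Fin.elim0, fun α => α.elim0, fun z => Subsingleton.elim _ _⟩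
  have : Module.Finite R Q := Module.Finite.of_restrictScalars_finite K R Q
  obtain ⟨i, q, φ, hq, hεq, hφq, hφ⟩ := exists_apply_eq_idempotent hε hsum hloc Q
  let Q' := LinearMap.ker φ
  -- The complementary projection along `R q`: it splits off `ker φ`, which is projective of smaller
  -- dimension because `q ∉ ker φ`.
  let p : Q →ₗ[R] Q' := LinearMap.codRestrict Q' (LinearMap.id - φ.smulRight q) fun z => by
    simp [Q', hφq, hφ]
  have hp : ∀ z : Q', p z = z := fun z => by
    have hz : φ z = 0 := z.2
    refine Subtype.ext ?_
    change (z : Q) - φ z • q = z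
    rw [hz, zero_smul, sub_zero]
  have hpq : p q = 0 := by
    refine Subtype.ext ?_
    change q - φ q • q = 0
    rw [hφq, hεq, sub_self]
  have : Module.Projective R Q' := Module.Projective.of_split Q'.subtype p (by ext z; simp [hp])
  have hlt : Module.finrank K Q' < d := by
    rw [← hd]
    refine Submodule.finrank_lt (s := Q'.restrictScalars K) (fun h => hq ?_)
    have hmem : q ∈ Q'.restrictScalars K := h ▸ Submodule.mem_top
    have h0 : φ q = 0 := hmem
    rw [← hεq, ← hφq, h0, zero_smul]
  have : FiniteDimensional K Q' :=
    inferInstanceAs (FiniteDimensional K (Q'.restrictScalars K))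
  obtain ⟨r, σ, q', φ', h1, h2⟩ := ih _ hlt Q' rfl
  have hφq' : ∀ α, φ (q' α) = 0 := fun α => (q' α).2
  refine ⟨r + 1, Fin.cons i σ, Fin.cons q fun α => q' α, Fin.cons φ fun α => φ' α ∘ₗ p, ?_, ?_⟩
  · intro α β
    refine Fin.cases ?_ (fun α => ?_) α <;> refine Fin.cases ?_ (fun β => ?_) β
    · simp [hφq]
    · simp [hpq, (Fin.succ_ne_zero β).symm]
    · simp [hφq']
    · simp [hp, h1]
  · intro z
    have h3 := congrArg (Subtype.val) (h2 (p z))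
    rw [Fin.sum_univ_succ]
    simp only [Fin.cons_zero, Fin.cons_succ, LinearMap.comp_apply]
    have h4 : ((p z : Q') : Q) = z - φ z • q := rfl
    rw [h4] at h3
    rw [Submodule.coe_sum] at h3
    simp only [Submodule.coe_smul] at h3
    rw [← h3]; abel

/-- The decomposition of the image of an idempotent endomorphism of a free module. -/
theorem exists_decomposition_range [FiniteDimensional K R] (hε : ∀ i, IsIdempotentElem (ε i))
    (hsum : ∑ i, ε i = 1) (hloc : ∀ i z, ∃ c : K, IsNilpotent (ε i * z * ε i - c • ε i))
    {κ : Type*} [Finite κ] {π : (κ → R) →ₗ[R] (κ → R)} (hπ : ∀ z, π (π z) = π z) :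
    ∃ (r : ℕ) (σ : Fin r → ι) (q : Fin r → κ → R) (Φ : (κ → R) →ₗ[R] R),
      (∀ z i, ∃ c : Fin r → R, π z i = ∑ α, c α * ε (σ α) * q α i) ∧
      ∀ α u, Φ (π fun i => u * q α i) = u * ε (σ α) := by
  let Q := LinearMap.range π
  let p : (κ → R) →ₗ[R] Q := π.rangeRestrict
  have hp : ∀ z : Q, p z = z := by
    rintro ⟨_, z, rfl⟩
    exact Subtype.ext (hπ z)
  have : Fintype κ := Fintype.ofFinite κ
  have : Module.Projective R Q := Module.Projective.of_split Q.subtype p (LinearMap.ext hp)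
  have : FiniteDimensional K Q :=
    inferInstanceAs (FiniteDimensional K (Q.restrictScalars K))
  obtain ⟨m, σ, q, φ, hφ, hq⟩ := exists_decomposition hε hsum hloc Q
  have hεq : ∀ α, ε (σ α) • q α = q α := fun α => by
    conv_rhs => rw [hq (q α)]
    simp [hφ, ite_smul]
  -- Adding all coordinate functionals gives one `Φ` that recovers `u * ε (σ α)` from `u • q α` for
  -- every `α` at once. This is what later allows the same map at all tensor positions.
  refine ⟨m, σ, fun α => (q α).1, (∑ β, φ β) ∘ₗ p, fun z i => ⟨fun α => φ α (p z), ?_⟩,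
    fun α u => ?_⟩
  · have h1 := congrFun (congrArg Subtype.val (hq (p z))) i
    change π z i = _ at h1
    rw [h1, Submodule.coe_sum, Finset.sum_apply]
    refine Finset.sum_congr rfl fun α _ => ?_
    conv_lhs => rw [← hεq α, smul_smul]
    rfl
  · have h3 : π (q α).1 = (q α).1 := congrArg Subtype.val (hp (q α))
    change ((∑ β, φ β) ∘ₗ p) (π (u • (q α).1)) = _
    rw [map_smul, map_smul, h3, LinearMap.comp_apply, hp, LinearMap.sum_apply]
    simp [hφ]

/-- The decomposition of the projective module given by an idempotent matrix. -/
theorem exists_decomposition_matrix [FiniteDimensional K R] (hε : ∀ i, IsIdempotentElem (ε i))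
    (hsum : ∑ i, ε i = 1) (hloc : ∀ i z, ∃ c : K, IsNilpotent (ε i * z * ε i - c • ε i))
    {κ : Type*} [Fintype κ] {η : κ → κ → R} (hη : ∀ i j, ∑ m, η i m * η m j = η i j) :
    ∃ (r : ℕ) (σ : Fin r → ι) (q : Fin r → κ → R) (c : κ → R),
      (∀ (z : κ → R) i, ∃ d : Fin r → R,
        ∑ m, z m * η m i = ∑ α, d α * ε (σ α) * q α i) ∧
      (∀ i, ∑ m, η i m * c m = c i) ∧ ∀ α u, ∃ z : κ → R, ∑ m, z m * c m = u * ε (σ α) := by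
  classical
  let π : (κ → R) →ₗ[R] (κ → R) :=
    { toFun := fun v j => ∑ m, v m * η m j
      map_add' := fun v v' => by ext j; simp [add_mul, Finset.sum_add_distrib]
      map_smul' := fun a v => by ext j; simp [Finset.mul_sum, mul_assoc] }
  have hπ' : ∀ v j, π v j = ∑ m, v m * η m j := fun _ _ => rfl
  have hπ : ∀ v, π (π v) = π v := by
    intro v
    ext j
    simp only [hπ', Finset.sum_mul]
    rw [Finset.sum_comm]
    refine Finset.sum_congr rfl fun m _ => ?_
    simp only [mul_assoc]
    rw [← Finset.mul_sum, hη]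
  obtain ⟨r, σ, q, Φ, hq, hΦ⟩ := exists_decomposition_range hε hsum hloc hπ
  have hc : ∀ v : κ → R, Φ (π v) = ∑ m, v m * Φ (π (Pi.single m 1)) := by
    intro v
    have hv : v = ∑ m, v m • (Pi.single m (1 : R) : κ → R) := by
      ext j
      simp [Finset.sum_apply, Pi.single_apply]
    conv_lhs => rw [hv]
    simp only [map_sum, map_smul, smul_eq_mul]
  -- The column `c` represents `Φ ∘ π` in the standard basis. The equation `η c = c` expresses that
  -- row `i` of `η` is `π` of the `i`-th basis vector and that `π` is idempotent.
  refine ⟨r, σ, q, fun m => Φ (π (Pi.single m 1)), hq, fun i => ?_, fun α u => ⟨fun i => u * q α i, ?_⟩⟩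
  · beta_reduce
    rw [← hc, ← hπ (Pi.single i 1)]
    congr 2
    ext j
    rw [hπ', Finset.sum_eq_single i]
    · simp
    · intro m _ hm; simp [hm]
    · simp
  · rw [← hΦ α u, hc]

end Decomposition

/-! ### Idempotents over an algebraically closed field -/

section Split

variable (K : Type*) [Field K] [IsAlgClosed K] (A : Type*) [Ring A] [Algebra K A]
  [FiniteDimensional K A]

/-- A finite dimensional algebra over an algebraically closed field has a complete system of
idempotents whose corners are scalar modulo a nilpotent ideal. -/
theorem exists_idempotents :
    ∃ (r : ℕ) (e : Fin r → A) (J : Submodule K A), (∀ i, IsIdempotentElem (e i)) ∧ ∑ i, e i = 1 ∧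
      (∀ a, ∀ j ∈ J, a * j ∈ J ∧ j * a ∈ J) ∧ IsNilpotent J ∧
      ∀ i a, ∃ c : K, e i * a * e i - c • e i ∈ J := by
  have := IsArtinianRing.of_finite K A
  let I := Ring.jacobson A
  have : FiniteDimensional K (A ⧸ I) := inferInstance
  obtain ⟨n, d, -, ⟨g⟩⟩ := IsSemisimpleRing.exists_algEquiv_pi_matrix_of_isAlgClosed K (A ⧸ I)
  let f : A →ₐ[K] (Π i, Matrix (Fin (d i)) (Fin (d i)) K) :=
    (g : _ →ₐ[K] _).comp (Ideal.Quotient.mkₐ K I)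
  have hf : Function.Surjective f :=
    g.surjective.comp (Ideal.Quotient.mkₐ_surjective K I)
  have hker : ∀ z, f z = 0 ↔ z ∈ I := fun z => by
    change g (Ideal.Quotient.mk I z) = 0 ↔ _
    rw [map_eq_zero_iff g g.injective, Ideal.Quotient.eq_zero_iff_mem]
  obtain ⟨N, hN⟩ := (IsSemiprimaryRing.isNilpotent : IsNilpotent (Ring.jacobson A))
  -- The diagonal matrix units of the Wedderburn decomposition modulo the radical; they lift to `A`
  -- because the radical is nilpotent.
  let e₀ : (Σ i, Fin (d i)) → Π i, Matrix (Fin (d i)) (Fin (d i)) K :=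
    fun s => Pi.single s.1 (Matrix.single s.2 s.2 1)
  have he₀ : CompleteOrthogonalIdempotents e₀ := by
    refine ⟨⟨fun s => ?_, fun s t hst => ?_⟩, ?_⟩
    · simp [e₀, IsIdempotentElem, ← Pi.single_mul]
    · obtain ⟨i, a⟩ := s
      obtain ⟨j, b⟩ := t
      by_cases hij : i = j
      · subst hij
        have hab : a ≠ b := fun h => hst (by rw [h])
        simp [e₀, ← Pi.single_mul, Matrix.single_mul_single_of_ne, hab]
      · simp only [e₀]
        ext l : 1
        by_cases hl : l = i
        · subst hl; simp [hij]
        · simp [hl]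
    · rw [Fintype.sum_sigma]
      simp only [e₀]
      ext i : 1
      rw [Finset.sum_apply, Finset.sum_eq_single i]
      · rw [Finset.sum_apply]
        simpa using Matrix.sum_single_one
      · intro j _ hj
        simp [hj.symm]
      · simp
  obtain ⟨e, he, hfe⟩ := CompleteOrthogonalIdempotents.lift_of_isNilpotent_ker (f : A →+* _)
    (fun z hz => ⟨N, by
      have hz' : z ∈ I := (hker z).1 hz
      have := Ideal.pow_mem_pow hz' N
      rw [hN] at this
      exact this⟩) he₀ (fun i => (hf (e₀ i)).imp fun _ h => h)
  let E := Fintype.equivFin (Σ i, Fin (d i))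
  refine ⟨_, e ∘ E.symm, I.restrictScalars K, fun i => he.idem _, ?_, ?_, ⟨N + 1, ?_⟩, ?_⟩
  · rw [← he.complete]; exact E.symm.sum_comp e
  · intro a j hj
    exact ⟨I.mul_mem_left a hj, I.mul_mem_right a hj⟩
  · have h : ∀ m, (I.restrictScalars K) ^ (m + 1) ≤ (I ^ (m + 1)).restrictScalars K := by
      intro m
      induction m with
      | zero => rw [zero_add, pow_one, Submodule.pow_one]
      | succ m ih =>
        rw [pow_succ]
        refine Submodule.mul_le.2 fun a ha b hb => ?_
        rw [Submodule.restrictScalars_mem, Submodule.pow_succ]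
        exact Ideal.mul_mem_mul (ih ha) hb
    have h0 : I ^ (N + 1) = 0 := by rw [Submodule.pow_succ, hN, zero_mul]
    refine le_bot_iff.1 ((h N).trans ?_)
    rw [h0]
    exact le_of_eq (Submodule.restrictScalars_bot ..)
  · intro i a
    obtain ⟨s, rfl⟩ := E.surjective i
    have hs : f (e s) = e₀ s := congrFun hfe s
    -- Cutting a matrix by a diagonal matrix unit on both sides leaves only its diagonal entry,
    -- which is the scalar.
    refine ⟨f a s.1 s.2 s.2, (hker _).1 ?_⟩
    simp only [Function.comp_apply, Equiv.symm_apply_apply, map_sub, map_mul, map_smul, hs]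
    obtain ⟨j, k⟩ := s
    ext l : 1
    by_cases hl : l = j
    · subst hl
      simp [e₀, Matrix.single_mul_mul_single]
    · simp [e₀, hl]

open Algebra.TensorProduct in
theorem commute_map_includeLeft_map_includeRight {K A B : Type*} [Field K] [Ring A] [Algebra K A]
    [Ring B] [Algebra K B] (S : Submodule K A) (T : Submodule K B) :
    Commute (S.map (includeLeft : A →ₐ[K] A ⊗[K] B).toLinearMap)
      (T.map (includeRight : B →ₐ[K] A ⊗[K] B).toLinearMap) := by
  refine le_antisymm ?_ ?_ <;> refine Submodule.mul_le.2 ?_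
  · rintro _ ⟨a, ha, rfl⟩ _ ⟨b, hb, rfl⟩
    have h : (a ⊗ₜ[K] 1 : A ⊗[K] B) * 1 ⊗ₜ b = (1 ⊗ₜ b) * (a ⊗ₜ 1) := by simp
    change (a ⊗ₜ[K] 1 : A ⊗[K] B) * 1 ⊗ₜ b ∈ _
    rw [h]
    exact Submodule.mul_mem_mul ⟨b, hb, rfl⟩ ⟨a, ha, rfl⟩
  · rintro _ ⟨b, hb, rfl⟩ _ ⟨a, ha, rfl⟩
    have h : (a ⊗ₜ[K] 1 : A ⊗[K] B) * 1 ⊗ₜ b = (1 ⊗ₜ b) * (a ⊗ₜ 1) := by simp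
    change (1 ⊗ₜ[K] b : A ⊗[K] B) * a ⊗ₜ 1 ∈ _
    rw [← h]
    exact Submodule.mul_mem_mul ⟨a, ha, rfl⟩ ⟨b, hb, rfl⟩

theorem commute_top_of_isTwoSided {K A : Type*} [Field K] [Ring A] [Algebra K A]
    {J : Submodule K A} (hJ : ∀ a, ∀ j ∈ J, a * j ∈ J ∧ j * a ∈ J) : Commute J ⊤ := by
  refine le_antisymm (Submodule.mul_le.2 fun a ha b _ => ?_) (Submodule.mul_le.2 fun b _ a ha => ?_)
  · simpa using Submodule.mul_mem_mul (Submodule.mem_top (x := (1 : A))) (hJ b a ha).2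
  · simpa using Submodule.mul_mem_mul (hJ b a ha).1 (Submodule.mem_top (x := (1 : A)))

theorem commute_map_of_commute {K A B : Type*} [Field K] [Ring A] [Algebra K A] [Ring B]
    [Algebra K B] (f : A →ₐ[K] B) {S T : Submodule K A} (h : Commute S T) :
    Commute (S.map f.toLinearMap) (T.map f.toLinearMap) := by
  change _ * _ = _ * _
  rw [← Submodule.map_mul, ← Submodule.map_mul, h.eq]

theorem isNilpotent_submodule_map {K A B : Type*} [Field K] [Ring A] [Algebra K A] [Ring B]
    [Algebra K B] (f : A →ₐ[K] B) {S : Submodule K A} (h : IsNilpotent S) :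
    IsNilpotent (S.map f.toLinearMap) := by
  obtain ⟨N, h⟩ := h
  refine ⟨N, ?_⟩
  rw [← Submodule.map_pow, h]
  exact Submodule.map_bot _

/-- Used in the semiring of submodules, where commuting submodules behave like commuting elements,
so the nilpotence of a sum of ideals needs no computation with elements. -/
theorem isNilpotent_mul_add_mul {S : Type*} [Semiring S] {a b c d : S} (hac : Commute a c)
    (had : Commute a d) (hbc : Commute b c) (hbd : Commute b d) (hab : Commute a b)
    (hcd : Commute c d) (ha : IsNilpotent a) (hd : IsNilpotent d) :
    IsNilpotent (a * b + c * d) :=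
  ((hac.mul_right had).mul_left (hbc.mul_right hbd)).isNilpotent_add
    (hab.isNilpotent_mul_right ha) (hcd.isNilpotent_mul_left hd)

open Algebra.TensorProduct in
/-- The elements of `J ⊗ B + A ⊗ J'`, for nilpotent ideals `J` and `J'`, are nilpotent. -/
theorem isNilpotent_map_mul_add_mul_map {K A B : Type*} [Field K] [Ring A] [Algebra K A]
    [Ring B] [Algebra K B] {J : Submodule K A} {J' : Submodule K B}
    (hJ : ∀ a, ∀ j ∈ J, a * j ∈ J ∧ j * a ∈ J) (hn : IsNilpotent J)
    (hJ' : ∀ a, ∀ j ∈ J', a * j ∈ J' ∧ j * a ∈ J') (hn' : IsNilpotent J') :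
    IsNilpotent (J.map (includeLeft : A →ₐ[K] A ⊗[K] B).toLinearMap *
        (⊤ : Submodule K B).map (includeRight : B →ₐ[K] A ⊗[K] B).toLinearMap +
      (⊤ : Submodule K A).map (includeLeft : A →ₐ[K] A ⊗[K] B).toLinearMap *
        J'.map (includeRight : B →ₐ[K] A ⊗[K] B).toLinearMap) := by
  exact isNilpotent_mul_add_mul (commute_map_of_commute _ (commute_top_of_isTwoSided hJ))
    (commute_map_includeLeft_map_includeRight _ _)
    (commute_map_includeLeft_map_includeRight _ _).symm
    (commute_map_of_commute _ (commute_top_of_isTwoSided hJ').symm)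
    (commute_map_includeLeft_map_includeRight _ _) (commute_map_includeLeft_map_includeRight _ _)
    (isNilpotent_submodule_map _ hn) (isNilpotent_submodule_map _ hn')

open Algebra.TensorProduct in
/-- The enveloping algebra of a finite dimensional algebra over an algebraically closed field has
a complete system of idempotents `eᵢ ⊗ eⱼ` with local corners. -/
theorem exists_idempotents_enveloping :
    ∃ (r : ℕ) (e : Fin r → A), (∀ i, IsIdempotentElem (e i)) ∧ ∑ i, e i = 1 ∧
      ∀ i j (z : A ⊗[K] Aᵐᵒᵖ), ∃ c : K, IsNilpotent
        ((e i ⊗ₜ MulOpposite.op (e j)) * z * (e i ⊗ₜ MulOpposite.op (e j)) -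
          c • (e i ⊗ₜ[K] MulOpposite.op (e j))) := by
  obtain ⟨r, e, J, he, hsum, hJ, hn, hloc⟩ := exists_idempotents K A
  refine ⟨r, e, he, hsum, fun i j z => ?_⟩
  let J' : Submodule K Aᵐᵒᵖ := J.map (MulOpposite.opLinearEquiv K : A ≃ₗ[K] Aᵐᵒᵖ).toLinearMap
  have hJ' : ∀ a, ∀ j ∈ J', a * j ∈ J' ∧ j * a ∈ J' := by
    rintro a _ ⟨j, hj, rfl⟩
    exact ⟨⟨j * a.unop, (hJ a.unop j hj).2, rfl⟩, ⟨a.unop * j, (hJ a.unop j hj).1, rfl⟩⟩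
  have hn' : IsNilpotent J' := by
    obtain ⟨N, hN⟩ := hn
    refine ⟨N, ?_⟩
    rw [← Submodule.map_op_pow, hN]
    exact Submodule.map_bot _
  obtain ⟨N, hN⟩ := isNilpotent_map_mul_add_mul_map hJ hn hJ' hn'
  set S := J.map (includeLeft : A →ₐ[K] A ⊗[K] Aᵐᵒᵖ).toLinearMap *
        (⊤ : Submodule K Aᵐᵒᵖ).map (includeRight : Aᵐᵒᵖ →ₐ[K] A ⊗[K] Aᵐᵒᵖ).toLinearMap +
      (⊤ : Submodule K A).map (includeLeft : A →ₐ[K] A ⊗[K] Aᵐᵒᵖ).toLinearMap *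
        J'.map (includeRight : Aᵐᵒᵖ →ₐ[K] A ⊗[K] Aᵐᵒᵖ).toLinearMap with hS
  have hS1 : ∀ a ∈ J, ∀ b : Aᵐᵒᵖ, a ⊗ₜ b ∈ S := fun a ha b => by
    have h : (a ⊗ₜ[K] b : A ⊗[K] Aᵐᵒᵖ) = (a ⊗ₜ 1) * (1 ⊗ₜ b) := by simp
    rw [h]
    exact Submodule.mem_sup_left (Submodule.mul_mem_mul ⟨a, ha, rfl⟩ ⟨b, trivial, rfl⟩)
  have hS2 : ∀ a, ∀ b ∈ J, a ⊗ₜ MulOpposite.op b ∈ S := fun a b hb => by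
    have h : (a ⊗ₜ[K] MulOpposite.op b : A ⊗[K] Aᵐᵒᵖ) = (a ⊗ₜ 1) * (1 ⊗ₜ MulOpposite.op b) := by
      simp
    rw [h]
    exact Submodule.mem_sup_right
      (Submodule.mul_mem_mul ⟨a, trivial, rfl⟩ ⟨_, ⟨b, hb, rfl⟩, rfl⟩)
  suffices h : ∃ c : K, ((e i ⊗ₜ MulOpposite.op (e j)) * z * (e i ⊗ₜ MulOpposite.op (e j)) -
      c • (e i ⊗ₜ[K] MulOpposite.op (e j))) ∈ S by
    obtain ⟨c, hc⟩ := h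
    refine ⟨c, N, ?_⟩
    have := Submodule.pow_mem_pow S hc N
    rw [hN] at this
    exact this
  induction z using TensorProduct.induction_on with
  | zero => exact ⟨0, by simp⟩
  | tmul a b =>
    obtain ⟨c, hc⟩ := hloc i a
    obtain ⟨c', hc'⟩ := hloc j b.unop
    refine ⟨c * c', ?_⟩
    -- Telescoping: replace the left corner by its scalar, then the right one. The two errors lie in
    -- `J ⊗ Aᵐᵒᵖ` and `A ⊗ J'`.
    have h : (e i ⊗ₜ MulOpposite.op (e j)) * (a ⊗ₜ b) * (e i ⊗ₜ MulOpposite.op (e j)) -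
        (c * c') • (e i ⊗ₜ[K] MulOpposite.op (e j)) =
        (e i * a * e i - c • e i) ⊗ₜ MulOpposite.op (e j * b.unop * e j) +
          (c • e i) ⊗ₜ MulOpposite.op (e j * b.unop * e j - c' • e j) := by
      simp only [tmul_mul_tmul, MulOpposite.op_sub, MulOpposite.op_mul, MulOpposite.op_unop,
        TensorProduct.sub_tmul, TensorProduct.tmul_sub, MulOpposite.op_smul,
        TensorProduct.tmul_smul, TensorProduct.smul_tmul', smul_smul, mul_assoc]
      rw [mul_comm c c']
      abel
    rw [h]
    exact add_mem (hS1 _ hc _) (hS2 _ _ hc')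
  | add z z' hz hz' =>
    obtain ⟨c, hc⟩ := hz
    obtain ⟨c', hc'⟩ := hz'
    refine ⟨c + c', ?_⟩
    convert add_mem hc hc' using 1
    rw [mul_add, add_mul, add_smul]
    abel

end Split

/-! ### Symmetrizing a nonvanishing trace form -/

section AlgClosed

variable {K : Type*} [Field K] {A : Type*} [Ring A] [Algebra K A]

theorem mul_tmul_mul_mem_span (e f : A) (z z' : A ⊗[K] Aᵐᵒᵖ) :
    z * (e ⊗ₜ MulOpposite.op f) * z' ∈ Submodule.span K {w : A ⊗[K] Aᵐᵒᵖ | ∃ x y x' y' : A,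
      w = (x * e * x') ⊗ₜ MulOpposite.op (y' * f * y)} := by
  induction z using TensorProduct.induction_on with
  | zero => simp
  | add a b ha hb => rw [add_mul, add_mul]; exact add_mem ha hb
  | tmul x y =>
    induction z' using TensorProduct.induction_on with
    | zero => simp
    | add a b ha hb => rw [mul_add]; exact add_mem ha hb
    | tmul x' y' =>
      refine Submodule.subset_span ⟨x, y.unop, x', y'.unop, ?_⟩
      simp [mul_assoc]

variable [IsAlgClosed K] [FiniteDimensional K A]

/-- If some trace form does not vanish on the coordinates of a projective module over the
enveloping algebra, then some cyclically symmetric trace form does not vanish on it. -/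
theorem exists_traceForm_ne_zero {ι : Type*} [Fintype ι] {n : ℕ}
    {η : ι → ι → A ⊗[K] Aᵐᵒᵖ} (hη : ∀ i j, ∑ m, η i m * η m j = η i j)
    {l : Fin (n + 1) → Module.Dual K A} {i : Fin (n + 1) → ι}
    {z : Fin (n + 1) → ι → A ⊗[K] Aᵐᵒᵖ}
    (h : traceForm l (fun s => ∑ m, z s m * η m (i s)) ≠ 0) :
    ∃ (ℓ : Module.Dual K A) (c : ι → A ⊗[K] Aᵐᵒᵖ) (z' : Fin (n + 1) → ι → A ⊗[K] Aᵐᵒᵖ),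
      (∀ i, ∑ m, η i m * c m = c i) ∧
        traceForm (fun _ => ℓ) (fun s => ∑ m, z' s m * c m) ≠ 0 := by
  obtain ⟨r, e, he, hsum, hloc⟩ := exists_idempotents_enveloping K A
  let ε : Fin r × Fin r → A ⊗[K] Aᵐᵒᵖ := fun p => e p.1 ⊗ₜ MulOpposite.op (e p.2)
  have hε : ∀ p, IsIdempotentElem (ε p) := fun p => by
    simp only [IsIdempotentElem, ε, Algebra.TensorProduct.tmul_mul_tmul, ← MulOpposite.op_mul,
      (he _).eq]
  have hεsum : ∑ p, ε p = 1 := by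
    simp only [ε]
    rw [Fintype.sum_prod_type]
    simp only [← TensorProduct.tmul_sum, ← TensorProduct.sum_tmul]
    rw [← Finset.op_sum, hsum]
    rfl
  obtain ⟨m, σ, q, c, hq, hc, hz⟩ :=
    exists_decomposition_matrix hε hεsum (fun p z => hloc p.1 p.2 z) hη
  -- Coordinates lie in the span of pure tensors passing through one idempotent `ε (σ α)`, so
  -- multilinearity provides such a pure tensor at each position.
  obtain ⟨w, hw, hw0⟩ : ∃ w : Fin (n + 1) → A ⊗[K] Aᵐᵒᵖ,
      (∀ s, ∃ (α : Fin m) (x y x' y' : A), w s =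
        (x * e (σ α).1 * x') ⊗ₜ MulOpposite.op (y' * e (σ α).2 * y)) ∧ traceForm l w ≠ 0 := by
    by_contra! H
    refine h ((traceForm l).eq_zero_of_mem_span (fun _ => {w | ∃ (α : Fin m) (x y x' y' : A), w =
        (x * e (σ α).1 * x') ⊗ₜ MulOpposite.op (y' * e (σ α).2 * y)}) H _ fun s => ?_)
    obtain ⟨d, hd⟩ := hq (z s) (i s)
    rw [hd]
    refine sum_mem fun α _ => ?_
    refine Submodule.span_mono ?_ (mul_tmul_mul_mem_span _ _ _ _)
    rintro _ ⟨x, y, x', y', rfl⟩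
    exact ⟨α, x, y, x', y', rfl⟩
  choose α x y x' y' hw using hw
  obtain rfl : w = _ := funext hw
  rw [traceForm_tmul, Finset.prod_ne_zero_iff] at hw0
  -- Each factor of the product of functionals has this corner element inside it, so the corner
  -- cannot vanish.
  have hne : ∀ s, e (σ (α s)).2 * (y s * x (s + 1)) * e (σ (α (s + 1))).1 ≠ 0 := by
    intro s hs
    apply hw0 s (Finset.mem_univ s)
    have : y' s * e (σ (α s)).2 * y s * (x (s + 1) * e (σ (α (s + 1))).1 * x' (s + 1)) =
        y' s * (e (σ (α s)).2 * (y s * x (s + 1)) * e (σ (α (s + 1))).1) * x' (s + 1) := by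
      simp only [mul_assoc]
    rw [this, hs, mul_zero, zero_mul, map_zero]
  -- The witness is indexed by the pair of idempotents and not by the position `s`. There are
  -- finitely many pairs and `K` is infinite, so a single `ℓ` is nonzero on all of the corner
  -- elements.
  choose a ha using fun t : {t : Fin r × Fin r // ∃ a, e t.1 * a * e t.2 ≠ 0} => t.2
  obtain ⟨ℓ, hℓ⟩ := Module.exists_dual_forall_apply_ne_zero (K := K) _ ha
  let t : Fin (n + 1) → {t : Fin r × Fin r // ∃ a, e t.1 * a * e t.2 ≠ 0} :=
    fun s => ⟨((σ (α s)).2, (σ (α (s + 1))).1), _, hne s⟩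
  -- With this multiplier, position `s` becomes `e_{iₛ} ⊗ (e_{jₛ} a e_{iₛ₊₁})`, and multiplying by
  -- the `e_{iₛ₊₁}` of the next position changes nothing.
  choose z' hz' using fun s => hz (α s) (1 ⊗ₜ MulOpposite.op (a (t s) * e (t s).1.2))
  refine ⟨ℓ, c, z', hc, ?_⟩
  have h2 : ∀ s, ∑ m, z' s m * c m =
      e (σ (α s)).1 ⊗ₜ MulOpposite.op (e (t s).1.1 * a (t s) * e (t s).1.2) := by
    intro s
    rw [hz']
    simp [ε, t, mul_assoc]
  simp only [h2]
  rw [traceForm_tmul, Finset.prod_ne_zero_iff]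
  intro s _
  have h4 := hℓ (t s)
  have h5 : e (σ (α (s + 1))).1 = e (t s).1.2 := rfl
  rwa [h5, mul_assoc _ (e (t s).1.2), (he _).eq]

end AlgClosed

/-! ### Base change of trace forms -/

section Descent

variable {k : Type*} [Field k] (K : Type*) [Field K] [Algebra k K]
  {A : Type*} [Ring A] [Algebra k A]

/-- The canonical map from the enveloping algebra of `A` to that of `K ⊗ A`. -/
noncomputable def envelopingMap : A ⊗[k] Aᵐᵒᵖ →ₐ[k] (K ⊗[k] A) ⊗[K] (K ⊗[k] A)ᵐᵒᵖ :=
  Algebra.TensorProduct.lift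
    (((Algebra.TensorProduct.includeLeft :
        K ⊗[k] A →ₐ[K] (K ⊗[k] A) ⊗[K] (K ⊗[k] A)ᵐᵒᵖ).restrictScalars k).comp
      (Algebra.TensorProduct.includeRight : A →ₐ[k] K ⊗[k] A))
    (((Algebra.TensorProduct.includeRight :
        (K ⊗[k] A)ᵐᵒᵖ →ₐ[K] (K ⊗[k] A) ⊗[K] (K ⊗[k] A)ᵐᵒᵖ).restrictScalars k).comp
      (AlgHom.op (Algebra.TensorProduct.includeRight : A →ₐ[k] K ⊗[k] A)))
    (fun a b => by simp [Commute, SemiconjBy])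

theorem envelopingMap_tmul (a b : A) : envelopingMap K (a ⊗ₜ[k] MulOpposite.op b) =
    ((1 : K) ⊗ₜ[k] a) ⊗ₜ[K] MulOpposite.op ((1 : K) ⊗ₜ[k] b) := by
  refine (Algebra.TensorProduct.lift_tmul _ _ _ a (MulOpposite.op b)).trans ?_
  simp

theorem span_range_envelopingMap :
    Submodule.span K (Set.range (envelopingMap K : A ⊗[k] Aᵐᵒᵖ → _)) = ⊤ := by
  refine eq_top_iff.2 fun z _ => ?_
  induction z using TensorProduct.induction_on with
  | zero => exact zero_mem _
  | add z z' h h' => exact add_mem (h trivial) (h' trivial)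
  | tmul a b =>
    obtain ⟨b, rfl⟩ := MulOpposite.op_surjective b
    induction a using TensorProduct.induction_on with
    | zero => rw [TensorProduct.zero_tmul]; exact zero_mem _
    | add a a' h h' => rw [TensorProduct.add_tmul]; exact add_mem (h trivial) (h' trivial)
    | tmul c a =>
      induction b using TensorProduct.induction_on with
      | zero => rw [MulOpposite.op_zero, TensorProduct.tmul_zero]; exact zero_mem _
      | add b b' h h' =>
        rw [MulOpposite.op_add, TensorProduct.tmul_add]; exact add_mem (h trivial) (h' trivial)
      | tmul d b =>
        have h : (c ⊗ₜ[k] a : K ⊗[k] A) ⊗ₜ[K] MulOpposite.op (d ⊗ₜ[k] b : K ⊗[k] A) =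
            (c * d) • envelopingMap K (a ⊗ₜ[k] MulOpposite.op b) := by
          rw [envelopingMap_tmul]
          have h1 : (c ⊗ₜ[k] a : K ⊗[k] A) = c • (1 ⊗ₜ a) := by
            rw [TensorProduct.smul_tmul', smul_eq_mul, mul_one]
          have h2 : (d ⊗ₜ[k] b : K ⊗[k] A) = d • (1 ⊗ₜ b) := by
            rw [TensorProduct.smul_tmul', smul_eq_mul, mul_one]
          rw [h1, h2, MulOpposite.op_smul, TensorProduct.tmul_smul, ← TensorProduct.smul_tmul',
            smul_smul, mul_comm]
        rw [h]
        exact Submodule.smul_mem _ _ (Submodule.subset_span ⟨_, rfl⟩)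

variable [FiniteDimensional k A]

theorem traceForm_envelopingMap {n : ℕ} (l : Fin (n + 1) → Module.Dual k A)
    (e : Fin (n + 1) → A ⊗[k] Aᵐᵒᵖ) :
    traceForm (fun s => (l s).baseChange K) (fun s => envelopingMap K (e s)) = algebraMap k K (traceForm l e) := by
  have h : ((traceForm (fun s => (l s).baseChange K)).restrictScalars k).compLinearMap
        (fun _ => (envelopingMap K : A ⊗[k] Aᵐᵒᵖ →ₐ[k] _).toLinearMap) =
      (Algebra.linearMap k K).compMultilinearMap (traceForm l) := by
    refine multilinear_ext_tmul fun a b => ?_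
    simp only [MultilinearMap.compLinearMap_apply, LinearMap.compMultilinearMap_apply,
      MultilinearMap.coe_restrictScalars, AlgHom.toLinearMap_apply, envelopingMap_tmul]
    rw [traceForm_tmul, traceForm_tmul, Algebra.linearMap_apply, map_prod]
    refine Finset.prod_congr rfl fun s _ => ?_
    simp [Algebra.smul_def]
  exact DFunLike.congr_fun h e

/-- If some trace form does not vanish on the coordinates of a projective module over the
enveloping algebra, then, after a base change to an algebraically closed field, some cyclically
symmetric trace form does not vanish on it. -/
theorem exists_traceForm_envelopingMap_ne_zero [IsAlgClosed K] {ι : Type*} [Fintype ι] {n : ℕ}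
    {ε : ι → ι → A ⊗[k] Aᵐᵒᵖ} (hε : ∀ i j, ∑ m, ε i m * ε m j = ε i j)
    {l : Fin (n + 1) → Module.Dual k A} {i : Fin (n + 1) → ι}
    {z : Fin (n + 1) → ι → A ⊗[k] Aᵐᵒᵖ}
    (h : traceForm l (fun s => ∑ m, z s m * ε m (i s)) ≠ 0) :
    ∃ (ℓ : Module.Dual K (K ⊗[k] A)) (c : ι → (K ⊗[k] A) ⊗[K] (K ⊗[k] A)ᵐᵒᵖ)
      (z' : Fin (n + 1) → ι → A ⊗[k] Aᵐᵒᵖ), (∀ i, ∑ m, envelopingMap K (ε i m) * c m = c i) ∧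
        traceForm (fun _ => ℓ) (fun s => ∑ m, envelopingMap K (z' s m) * c m) ≠ 0 := by
  classical
  have hη : ∀ i j, ∑ m, envelopingMap K (ε i m) * envelopingMap K (ε m j) =
      envelopingMap K (ε i j) := fun i j => by
    simp only [← map_mul, ← map_sum, hε]
  obtain ⟨ℓ, c, w, hc, hw⟩ := exists_traceForm_ne_zero (z := fun s m => envelopingMap K (z s m)) hη
    (i := i) (l := fun s => (l s).baseChange K) (by
        simp only [← map_mul, ← map_sum]
        rw [traceForm_envelopingMap]
        simpa using h)
  refine ⟨ℓ, c, ?_⟩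
  -- If the form vanished on all `k`-rational combinations of `c`, it would vanish on their
  -- `K`-span, which contains the coordinates supplied by the algebraically closed case.
  by_contra! H
  refine hw ((traceForm _).eq_zero_of_mem_span
    (fun _ => Set.range fun z' : ι → A ⊗[k] Aᵐᵒᵖ => ∑ m, envelopingMap K (z' m) * c m)
    (fun t ht => ?_) _ fun s => ?_)
  · choose z' hz' using ht
    obtain rfl := funext hz'
    exact H z' hc
  · refine sum_mem fun m _ => ?_
    have hm : w s m ∈ Submodule.span K (Set.range (envelopingMap K : A ⊗[k] Aᵐᵒᵖ → _)) := by
      rw [span_range_envelopingMap]; trivial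
    generalize w s m = b at hm
    induction hm using Submodule.span_induction with
    | zero => rw [zero_mul]; exact zero_mem _
    | add a b _ _ ha hb => rw [add_mul]; exact add_mem ha hb
    | smul a b _ hb => rw [smul_mul_assoc]; exact Submodule.smul_mem _ _ hb
    | mem a ha =>
      obtain ⟨e, rfl⟩ := ha
      refine Submodule.subset_span ⟨Pi.single m e, ?_⟩
      beta_reduce
      rw [Finset.sum_eq_single m]
      · simp
      · intro m' _ hm; simp [hm]
      · simp

end Descent

/-! ### Balancedness and cyclic symmetry of trace forms -/

section TraceFormSymmetry

variable {K : Type*} [Field K] {A : Type*} [Ring A] [Algebra K A] [FiniteDimensional K A]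

/-- On pure tensors, both sides insert `b s` between the right leg at `s` and the left leg at `s +
1`. This is the relation needed to factor over `H₀`. -/
theorem traceForm_balanced {n : ℕ} (ℓ : Fin (n + 1) → Module.Dual K A) (b : Fin (n + 1) → A)
    (e : Fin (n + 1) → A ⊗[K] Aᵐᵒᵖ) :
    traceForm ℓ (fun s => (1 ⊗ₜ MulOpposite.op (b s)) * e s) =
      traceForm ℓ (fun s => (b (s - 1) ⊗ₜ 1) * e s) := by
  have h : (traceForm ℓ).compLinearMap
        (fun s => LinearMap.mulLeft K ((1 : A) ⊗ₜ[K] MulOpposite.op (b s))) =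
      (traceForm ℓ).compLinearMap
        (fun s => LinearMap.mulLeft K (b (s - 1) ⊗ₜ[K] (1 : Aᵐᵒᵖ))) := by
    refine multilinear_ext_tmul fun x y => ?_
    simp only [MultilinearMap.compLinearMap_apply, LinearMap.mulLeft_apply,
      Algebra.TensorProduct.tmul_mul_tmul, one_mul, ← MulOpposite.op_mul, traceForm_tmul,
      add_sub_cancel_right, mul_assoc]
  exact DFunLike.congr_fun h e

theorem traceForm_rotate {n : ℕ} (ℓ : Module.Dual K A) (e : Fin (n + 1) → A ⊗[K] Aᵐᵒᵖ) :
    traceForm (fun _ => ℓ) (fun s => e ((finRotate (n + 1)).symm s)) =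
      traceForm (fun _ => ℓ) e := by
  have h : (traceForm (fun _ : Fin (n + 1) => ℓ)).domDomCongr (finRotate (n + 1)).symm =
      traceForm (fun _ => ℓ) := by
    refine multilinear_ext_tmul fun x y => ?_
    rw [MultilinearMap.domDomCongr_apply, traceForm_tmul, traceForm_tmul,
      ← Equiv.prod_comp (finRotate (n + 1))]
    refine Finset.prod_congr rfl fun s _ => ?_
    rw [Equiv.symm_apply_apply, ← finRotate_apply (i := finRotate (n + 1) s),
      Equiv.symm_apply_apply, finRotate_apply]
  exact DFunLike.congr_fun h e

end TraceFormSymmetry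

namespace Bimod

/-! ### Dual bases of projective bimodules -/

section DualBasis

variable (k : Type*) [Field k] (A : Type*) [Ring A] [Algebra k A] (B : Type*) [Ring B] [Algebra k B]
  (P : Type*) [AddCommGroup P] [Module k P] [Module A P] [Module Bᵐᵒᵖ P]
  [IsScalarTower k A P] [IsScalarTower k Bᵐᵒᵖ P] [SMulCommClass A Bᵐᵒᵖ P]

/-- The action of `A ⊗ Bᵐᵒᵖ` on an `A`-`B`-bimodule. -/
noncomputable def envAct : A ⊗[k] Bᵐᵒᵖ →ₐ[k] Module.End k P :=
  Algebra.TensorProduct.lift (Algebra.lsmul k k P) (Algebra.lsmul k k P)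
    fun a b => LinearMap.ext fun p => smul_comm a b p

variable {A B P} in
theorem envAct_tmul (a : A) (b : Bᵐᵒᵖ) (p : P) : envAct k A B P (a ⊗ₜ b) p = a • b • p := by
  have h := Algebra.TensorProduct.lift_tmul (Algebra.lsmul k k P : A →ₐ[k] Module.End k P)
    (Algebra.lsmul k k P : Bᵐᵒᵖ →ₐ[k] Module.End k P)
    (fun a b => LinearMap.ext fun p => smul_comm a b p) a b
  exact LinearMap.congr_fun h p

/-- A finite dual basis of an `A`-`B`-bimodule as a module over `A ⊗ Bᵐᵒᵖ`. -/
structure DualBasis (ι : Type*) [Fintype ι] where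
  vec : ι → P
  coord : ι → P →ₗ[k] A ⊗[k] Bᵐᵒᵖ
  coord_smul : ∀ i (a : A) (p : P), coord i (a • p) = (a ⊗ₜ 1) * coord i p
  coord_op_smul : ∀ i (b : Bᵐᵒᵖ) (p : P), coord i (b • p) = (1 ⊗ₜ b) * coord i p
  sum_coord : ∀ p, ∑ i, envAct k A B P (coord i p) (vec i) = p

variable {k A B P} {ι : Type*} [Fintype ι] (d : DualBasis k A B P ι)

theorem DualBasis.coord_envAct (i : ι) (e : A ⊗[k] Bᵐᵒᵖ) (p : P) :
    d.coord i (envAct k A B P e p) = e * d.coord i p := by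
  induction e using TensorProduct.induction_on with
  | zero => simp
  | add e e' h h' => rw [map_add, LinearMap.add_apply, map_add, h, h', add_mul]
  | tmul a b =>
    rw [envAct_tmul, d.coord_smul, d.coord_op_smul, ← mul_assoc,
      Algebra.TensorProduct.tmul_mul_tmul, mul_one, one_mul]

/-- Taking `p = d.vec j` shows that the matrix of coordinates of the generators is idempotent; this
is the form in which projectivity enters the decomposition. -/
theorem DualBasis.coord_eq_sum (i : ι) (p : P) :
    d.coord i p = ∑ m, d.coord m p * d.coord i (d.vec m) := by
  conv_lhs => rw [← d.sum_coord p]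
  rw [map_sum]
  exact Finset.sum_congr rfl fun m _ => d.coord_envAct _ _ _

include d in
theorem DualBasis.finite [FiniteDimensional k A] [FiniteDimensional k B] :
    FiniteDimensional k P := by
  have hB : FiniteDimensional k Bᵐᵒᵖ := inferInstance
  refine Module.Finite.of_surjective
    (∑ i, ((envAct k A B P).toLinearMap.flip (d.vec i)) ∘ₗ LinearMap.proj i :
      (ι → A ⊗[k] Bᵐᵒᵖ) →ₗ[k] P) fun p => ⟨fun i => d.coord i p, ?_⟩
  simpa using d.sum_coord p

end DualBasis

end Bimod

namespace Bimod

/-! ### Functionals on the zeroth Hochschild homology -/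

section Functionals

variable {k : Type*} [Field k] {A : Type*} [Ring A] [Algebra k A]
  {P : Type*} [AddCommGroup P] [Module k P] [Module A P] [Module Aᵐᵒᵖ P]
  [IsScalarTower k A P] [IsScalarTower k Aᵐᵒᵖ P] [SMulCommClass A Aᵐᵒᵖ P]
  {Z : Type*} [AddCommGroup Z] [Module k Z] {n : ℕ}

theorem clsLinear_ext {f g : H0 k A (TensorPow k A P n) →ₗ[k] Z}
    (h : ∀ p : Fin (n + 1) → P, f (cls k A p) = g (cls k A p)) : f = g :=
  Submodule.linearMap_qext _ (tensorPow_ext h)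

/-- A cyclically balanced multilinear map factors over `H₀(A, P ⊗_A ⋯ ⊗_A P)`. -/
theorem exists_lift_cls (f : MultilinearMap k (fun _ : Fin (n + 1) => P) Z)
    (hf : ∀ (p : Fin (n + 1) → P) (j : Fin (n + 1)) (a : A),
      f (Function.update p j (MulOpposite.op a • p j)) =
        f (Function.update p (j + 1) (a • p (j + 1)))) :
    ∃ F : H0 k A (TensorPow k A P n) →ₗ[k] Z, ∀ p, F (cls k A p) = f p := by
  have h1 : powRel k A P n ≤ LinearMap.ker (PiTensorProduct.lift f) := by
    refine Submodule.span_le.2 ?_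
    rintro _ ⟨p, i, a, rfl⟩
    rw [SetLike.mem_coe, LinearMap.mem_ker, map_sub, sub_eq_zero, PiTensorProduct.lift.tprod,
      PiTensorProduct.lift.tprod, hf]
    simp
  let F₁ : TensorPow k A P n →ₗ[k] Z := (powRel k A P n).liftQ _ h1
  have hF₁ : ∀ p, F₁ (TensorPow.tprod k A p) = f p := fun p => PiTensorProduct.lift.tprod p
  have h2 : commutators k A (TensorPow k A P n) ≤ LinearMap.ker F₁ := by
    refine Submodule.span_le.2 ?_
    rintro _ ⟨a, z, rfl⟩
    rw [SetLike.mem_coe, LinearMap.mem_ker, map_sub, sub_eq_zero]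
    have h : F₁.comp (powLeftHom k A P n a) = F₁.comp (powRightHom k A P n (MulOpposite.op a)) := by
      refine tensorPow_ext fun p => ?_
      change F₁ (a • TensorPow.tprod k A p) = F₁ (MulOpposite.op a • TensorPow.tprod k A p)
      rw [smul_tprod, op_smul_tprod, hF₁, hF₁, hf]
      simp
    exact LinearMap.congr_fun h z
  exact ⟨(commutators k A (TensorPow k A P n)).liftQ F₁ h2, hF₁⟩

/-- Scalars at different positions can be moved one after another, since left and right actions on
the same factor commute; the induction is over the set of positions already moved. -/
theorem cls_op_smul_eq (b : Fin (n + 1) → A) (p : Fin (n + 1) → P) :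
    cls k A (fun s => MulOpposite.op (b s) • p s) = cls k A (fun s => b (s - 1) • p s) := by
  classical
  suffices H : ∀ (S : Finset (Fin (n + 1))) (p : Fin (n + 1) → P),
      cls k A (fun s => if s ∈ S then MulOpposite.op (b s) • p s else p s) =
        cls k A (fun s => if s - 1 ∈ S then b (s - 1) • p s else p s) by
    simpa using H Finset.univ p
  intro S
  induction S using Finset.induction_on with
  | empty => intro p; simp
  | insert a S ha ih =>
    intro p
    have key := cls_cyclic k A P (fun s => if s ∈ S then MulOpposite.op (b s) • p s else p s) a (b a)
    rw [finRotate_apply] at key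
    have h1 : (fun s => if s ∈ insert a S then MulOpposite.op (b s) • p s else p s) =
        Function.update (fun s => if s ∈ S then MulOpposite.op (b s) • p s else p s) a
          (MulOpposite.op (b a) • if a ∈ S then MulOpposite.op (b a) • p a else p a) := by
      ext s
      by_cases hs : s = a
      · subst hs; simp [ha]
      · simp [hs]
    have h2 : Function.update (fun s => if s ∈ S then MulOpposite.op (b s) • p s else p s) (a + 1)
          (b a • if a + 1 ∈ S then MulOpposite.op (b (a + 1)) • p (a + 1) else p (a + 1)) =
        fun s => if s ∈ S then MulOpposite.op (b s) • Function.update p (a + 1) (b a • p (a + 1)) s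
          else Function.update p (a + 1) (b a • p (a + 1)) s := by
      ext s
      by_cases hs : s = a + 1
      · subst hs
        simp only [Function.update_self]
        split_ifs
        · rw [smul_comm]
        · rfl
      · simp [hs]
    rw [h1, key, h2, ih]
    congr 1
    ext s
    by_cases hs : s = a + 1
    · subst hs; simp [ha]
    · have hs' : s - 1 ≠ a := fun h => hs (by rw [← h, sub_add_cancel])
      simp [hs, hs']

end Functionals

/-! ### Functionals as combinations of trace forms -/

section Nonvanishing

variable {k : Type*} [Field k] {A : Type*} [Ring A] [Algebra k A] [FiniteDimensional k A]
  {P : Type*} [AddCommGroup P] [Module k P] [Module A P] [Module Aᵐᵒᵖ P]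
  [IsScalarTower k A P] [IsScalarTower k Aᵐᵒᵖ P] [SMulCommClass A Aᵐᵒᵖ P] {n : ℕ}

/-- The class of a tensor as a multilinear map. -/
noncomputable def clsMultilinear :
    MultilinearMap k (fun _ : Fin (n + 1) => P) (H0 k A (TensorPow k A P n)) :=
  ((commutators k A (TensorPow k A P n)).mkQ ∘ₗ (powRel k A P n).mkQ).compMultilinearMap
    (PiTensorProduct.tprod k)

/-- A functional on `H₀(A, P ⊗_A ⋯ ⊗_A P)` is a combination of trace forms. -/
theorem apply_cls_envAct_eq_zero (g : H0 k A (TensorPow k A P n) →ₗ[k] k) (q : Fin (n + 1) → P)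
    (e : Fin (n + 1) → A ⊗[k] Aᵐᵒᵖ) (h : ∀ l : Fin (n + 1) → Module.Dual k A, traceForm l e = 0) :
    g (cls k A fun s => envAct k A A P (e s) (q s)) = 0 := by
  classical
  let b := Module.finBasis k A
  -- Once every left factor has been moved cyclically to the preceding position, only the products
  -- `y s * x (s + 1)` act, from the right. Expanding `G` in a basis of `A` turns the value into a
  -- combination of trace forms of dual basis functionals.
  let G : MultilinearMap k (fun _ : Fin (n + 1) => A) k :=
    (g.compMultilinearMap clsMultilinear).compLinearMap
      fun s => ((Algebra.lsmul k k P : Aᵐᵒᵖ →ₐ[k] Module.End k P).toLinearMap.flip (q s)) ∘ₗ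
        (MulOpposite.opLinearEquiv k : A ≃ₗ[k] Aᵐᵒᵖ).toLinearMap
  have hG : ∀ a, G a = g (cls k A fun s => MulOpposite.op (a s) • q s) := fun _ => rfl
  have hG' : ∀ a, G a = ∑ f : Fin (n + 1) → Fin (Module.finrank k A),
      G (fun s => b (f s)) * ∏ s, b.coord (f s) (a s) := by
    intro a
    have ha : a = fun s => ∑ i, b.coord i (a s) • b i := by
      ext s; simp [b.sum_repr]
    conv_lhs => rw [ha, MultilinearMap.map_sum]
    refine Finset.sum_congr rfl fun f _ => ?_
    rw [MultilinearMap.map_smul_univ, smul_eq_mul, mul_comm]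
  have key : (g.compMultilinearMap clsMultilinear).compLinearMap
      (fun s => (envAct k A A P).toLinearMap.flip (q s)) =
      ∑ f : Fin (n + 1) → Fin (Module.finrank k A),
        G (fun s => b (f s)) • traceForm (fun s => b.coord (f s)) := by
    refine multilinear_ext_tmul fun x y => ?_
    have h1 : ((g.compMultilinearMap clsMultilinear).compLinearMap
        (fun s => (envAct k A A P).toLinearMap.flip (q s)))
          (fun s => x s ⊗ₜ MulOpposite.op (y s)) =
        g (cls k A fun s => x s • MulOpposite.op (y s) • q s) := by
      change g (cls k A fun s => envAct k A A P (x s ⊗ₜ MulOpposite.op (y s)) (q s)) = _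
      simp only [envAct_tmul]
    rw [h1]
    have h2 := cls_op_smul_eq (k := k) (fun s => x (s + 1)) (fun s => MulOpposite.op (y s) • q s)
    simp only [sub_add_cancel, smul_smul, ← MulOpposite.op_mul] at h2
    rw [← h2, ← hG, hG', sum_apply]
    refine Finset.sum_congr rfl fun f _ => ?_
    rw [smul_apply, traceForm_tmul, smul_eq_mul]
  have := DFunLike.congr_fun key e
  rw [sum_apply] at this
  refine this.trans (Finset.sum_eq_zero fun f _ => ?_)
  rw [smul_apply, h, smul_zero]

end Nonvanishing
end Bimod

namespace Bimod

/-! ### The invariant functional -/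

section Invariants

variable {k : Type*} [Field k] {A : Type*} [Ring A] [Algebra k A] [FiniteDimensional k A]
  {P : Type*} [AddCommGroup P] [Module k P] [Module A P] [Module Aᵐᵒᵖ P]
  [IsScalarTower k A P] [IsScalarTower k Aᵐᵒᵖ P] [SMulCommClass A Aᵐᵒᵖ P] {n : ℕ}
  {ι : Type*} [Fintype ι]

theorem DualBasis.exists_traceForm_ne_zero (d : DualBasis k A A P ι)
    [Nontrivial (H0 k A (TensorPow k A P n))] :
    ∃ (l : Fin (n + 1) → Module.Dual k A) (i : Fin (n + 1) → ι) (p : Fin (n + 1) → P),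
      traceForm l (fun s => d.coord (i s) (p s)) ≠ 0 := by
  classical
  by_contra! H
  obtain ⟨x, hx⟩ := exists_ne (0 : H0 k A (TensorPow k A P n))
  refine hx ((Module.forall_dual_apply_eq_zero_iff k x).1 fun g => ?_)
  suffices hg : g = 0 by rw [hg, LinearMap.zero_apply]
  refine clsLinear_ext fun p => ?_
  have h1 : p = fun s => ∑ i, envAct k A A P (d.coord i (p s)) (d.vec i) :=
    funext fun s => (d.sum_coord (p s)).symm
  have h2 : g (cls k A p) = (g.compMultilinearMap clsMultilinear) p := rfl
  rw [h2, LinearMap.zero_apply]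
  conv_lhs => rw [h1, MultilinearMap.map_sum]
  exact Finset.sum_eq_zero fun i _ =>
    apply_cls_envAct_eq_zero g (fun s => d.vec (i s)) _ fun l => H l i p

theorem DualBasis.exists_invariant_functional (d : DualBasis k A A P ι)
    [Nontrivial (H0 k A (TensorPow k A P n))] :
    ∃ F : H0 k A (TensorPow k A P n) →ₗ[k] AlgebraicClosure k,
      F ∘ₗ rotate k A P n = F ∧ F ≠ 0 := by
  classical
  obtain ⟨l, i, p, h⟩ := d.exists_traceForm_ne_zero (n := n)
  let K := AlgebraicClosure k
  have hε : ∀ i j, ∑ m, d.coord m (d.vec i) * d.coord j (d.vec m) = d.coord j (d.vec i) :=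
    fun i j => (d.coord_eq_sum j (d.vec i)).symm
  simp only [fun s => d.coord_eq_sum (i s) (p s)] at h
  obtain ⟨ℓ, c, z, hc, hz⟩ := exists_traceForm_envelopingMap_ne_zero K
    (ε := fun i j => d.coord j (d.vec i)) hε (z := fun s m => d.coord m (p s)) h
  -- The map of `P` to the enveloping algebra of `K ⊗ A` defined by the column `c`, linear over the
  -- two actions of `A`; using it at every position is what makes the form symmetric.
  let Ψ : P →ₗ[k] (K ⊗[k] A) ⊗[K] (K ⊗[k] A)ᵐᵒᵖ :=
    ∑ m, LinearMap.mulRight k (c m) ∘ₗ (envelopingMap K).toLinearMap ∘ₗ d.coord m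
  have hΨ : ∀ p, Ψ p = ∑ m, envelopingMap K (d.coord m p) * c m := fun p => by
    simp [Ψ, LinearMap.sum_apply]
  have hΨ' : ∀ e p, Ψ (envAct k A A P e p) = envelopingMap K e * Ψ p := fun e p => by
    simp only [hΨ, d.coord_envAct, map_mul, Finset.mul_sum, mul_assoc]
  have hl : ∀ (a : A) (p : P), Ψ (a • p) = (((1 : K) ⊗ₜ[k] a) ⊗ₜ[K] 1) * Ψ p := fun a p => by
    have := hΨ' (a ⊗ₜ MulOpposite.op 1) p
    rw [envAct_tmul, envelopingMap_tmul, ← Algebra.TensorProduct.one_def, MulOpposite.op_one,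
      MulOpposite.op_one, one_smul] at this
    exact this
  have hr : ∀ (a : A) (p : P), Ψ (MulOpposite.op a • p) =
      (1 ⊗ₜ[K] MulOpposite.op ((1 : K) ⊗ₜ[k] a)) * Ψ p := fun a p => by
    have := hΨ' (1 ⊗ₜ MulOpposite.op a) p
    rw [envAct_tmul, envelopingMap_tmul, ← Algebra.TensorProduct.one_def, one_smul] at this
    exact this
  let f : MultilinearMap k (fun _ : Fin (n + 1) => P) K :=
    ((traceForm (fun _ => ℓ)).restrictScalars k).compLinearMap fun _ => Ψ
  have hf : ∀ p, f p = traceForm (fun _ => ℓ) fun s => Ψ (p s) := fun _ => rfl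
  obtain ⟨F, hF⟩ := exists_lift_cls (A := A) f fun p j a => by
    rw [hf, hf]
    -- All scalars are `1` except at position `j`, so the simultaneous relation reduces to the one
    -- that moves `a` from `j` to `j + 1`.
    have key := traceForm_balanced (fun _ => ℓ)
      (Function.update 1 j ((1 : K) ⊗ₜ[k] a)) (fun s => Ψ (p s))
    convert key using 2
    · ext s
      by_cases hs : s = j
      · subst hs; simp [hr]
      · simp [hs, ← Algebra.TensorProduct.one_def]
    · ext s
      by_cases hs : s = j + 1
      · subst hs; simp [hl]
      · have hs' : s - 1 ≠ j := fun h => hs (by rw [← h, sub_add_cancel])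
        simp [hs, hs', ← Algebra.TensorProduct.one_def]
  refine ⟨F, clsLinear_ext fun p => ?_, fun h0 => hz ?_⟩
  · rw [LinearMap.comp_apply, rotate_cls, hF, hF, hf, hf]
    exact traceForm_rotate ℓ fun s => Ψ (p s)
  -- The equation `ε c = c` gives `Ψ (d.vec i) = c i`, so the nonzero value is attained at the class
  -- of the tensor with factors `∑ m, z s m • d.vec m`.
  · have hvec : ∀ i, Ψ (d.vec i) = c i := fun i => by rw [hΨ, hc]
    have h1 := hF fun s => ∑ m, envAct k A A P (z s m) (d.vec m)
    rw [h0, LinearMap.zero_apply, hf] at h1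
    simpa only [map_sum, hΨ', hvec] using h1.symm

/-- In finite dimension, invariants and coinvariants of `t` vanish together; a nonzero invariant
functional contradicts the vanishing of the coinvariants. -/
theorem DualBasis.subsingleton_of_rotate (d : DualBasis k A A P ι)
    (h : ∀ x, rotate k A P n x = x → x = 0) : Subsingleton (H0 k A (TensorPow k A P n)) := by
  by_contra hns
  rw [not_subsingleton_iff_nontrivial] at hns
  obtain ⟨F, hF, hF0⟩ := d.exists_invariant_functional (n := n)
  have := d.finite
  have : FiniteDimensional k (TensorPow k A P n) :=
    inferInstanceAs (FiniteDimensional k ((⨂[k] _ : Fin (n + 1), P) ⧸ powRel k A P n))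
  let T : Module.End k (H0 k A (TensorPow k A P n)) := rotate k A P n - 1
  have hinj : Function.Injective T := by
    rw [← LinearMap.ker_eq_bot, LinearMap.ker_eq_bot']
    exact fun x hx => h x (sub_eq_zero.1 hx)
  refine hF0 (LinearMap.ext fun x => ?_)
  obtain ⟨y, rfl⟩ := LinearMap.injective_iff_surjective.1 hinj x
  change F (rotate k A P n y - y) = _
  rw [map_sub, LinearMap.zero_apply, sub_eq_zero]
  exact LinearMap.congr_fun hF y

omit [FiniteDimensional k A] in
theorem rotate_invariant {x : H0 k A (TensorPow k A P n)} (hx : rotate k A P n x = x) :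
    x ∈ (cyclicRep k A P n).invariants := by
  intro g
  change (rotate k A P n ^ _) x = x
  generalize (Multiplicative.toAdd g).val = j
  induction j with
  | zero => rfl
  | succ j ih => rw [pow_succ, Module.End.mul_apply, hx, ih]

end Invariants
end Bimod

namespace Bimod

/-! ### From projectivity to a dual basis -/

section Projective

variable {k : Type*} [Field k] {A : Type*} [Ring A] [Algebra k A] {B : Type*} [Ring B] [Algebra k B]
  {P : Type*} [AddCommGroup P] [Module k P] [Module A P] [Module Bᵐᵒᵖ P]
  [IsScalarTower k A P] [IsScalarTower k Bᵐᵒᵖ P] [SMulCommClass A Bᵐᵒᵖ P]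

theorem exists_dualBasis (h : IsFGProjectiveBimodule k A B P) :
    ∃ r : ℕ, Nonempty (DualBasis k A B P (Fin r)) := by
  let _ : Module (A ⊗[k] Bᵐᵒᵖ) P := TensorProduct.Algebra.module
  obtain ⟨h1, h2⟩ := h
  obtain ⟨r, f, g, -, -, hfg⟩ := Module.Finite.exists_comp_eq_id_of_projective (A ⊗[k] Bᵐᵒᵖ) P
  have hs : ∀ (a : A) (b : Bᵐᵒᵖ) (p : P), (a ⊗ₜ[k] b : A ⊗[k] Bᵐᵒᵖ) • p = a • b • p :=
    fun a b p => TensorProduct.Algebra.smul_def a b p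
  have hact : ∀ (e : A ⊗[k] Bᵐᵒᵖ) (p : P), envAct k A B P e p = e • p := by
    intro e p
    induction e using TensorProduct.induction_on with
    | zero => rw [map_zero]; exact (zero_smul (A ⊗[k] Bᵐᵒᵖ) p).symm
    | add e e' h h' => rw [map_add, LinearMap.add_apply, h, h', add_smul]
    | tmul a b => rw [envAct_tmul, hs]
  have hg1 : ∀ (a : A) (p : P) i, g (a • p) i = (a ⊗ₜ 1) * g p i := fun a p i => by
    rw [← one_smul Bᵐᵒᵖ p, ← hs, map_smul, one_smul]; rfl
  have hg2 : ∀ (b : Bᵐᵒᵖ) (p : P) i, g (b • p) i = (1 ⊗ₜ b) * g p i := fun b p i => by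
    rw [← one_smul A (b • p), ← hs, map_smul]; rfl
  refine ⟨r, ⟨⟨fun i => f (Pi.single i 1), fun i =>
    { toFun := fun p => g p i
      map_add' := fun p q => by rw [map_add]; rfl
      map_smul' := fun c p => ?_ }, fun i a p => hg1 a p i, fun i b p => hg2 b p i, fun p => ?_⟩⟩⟩
  · rw [← algebraMap_smul A c p, hg1, Algebra.algebraMap_eq_smul_one, ← TensorProduct.smul_tmul',
      ← Algebra.TensorProduct.one_def, smul_mul_assoc, one_mul]
    rfl
  · have h3 : f (g p) = p := LinearMap.congr_fun hfg p
    conv_rhs => rw [← h3, ← Finset.univ_sum_single (g p), map_sum]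
    refine Finset.sum_congr rfl fun i _ => ?_
    change envAct k A B P (g p i) _ = _
    rw [hact, ← map_smul]
    congr 1
    ext j
    by_cases hj : j = i
    · subst hj; simp
    · simp [hj]

end Projective

/-! ### The tensor product of two projective bimodules -/

section Tensor

variable {k : Type*} [Field k] {A : Type*} [Ring A] [Algebra k A] {B : Type*} [Ring B] [Algebra k B]
  {C : Type*} [Ring C] [Algebra k C]

/-- The bilinear map `(a ⊗ b, b' ⊗ c) ↦ ℓ (b b') a ⊗ c`. -/
noncomputable def contract (ℓ : Module.Dual k B) :
    A ⊗[k] Bᵐᵒᵖ →ₗ[k] B ⊗[k] Cᵐᵒᵖ →ₗ[k] A ⊗[k] Cᵐᵒᵖ :=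
  TensorProduct.lift (LinearMap.mk₂ k
    (fun (a : A) (b : Bᵐᵒᵖ) =>
      TensorProduct.map ((ℓ ∘ₗ LinearMap.mulLeft k b.unop).smulRight a) LinearMap.id)
    (fun a a' b => by ext; simp [TensorProduct.add_tmul])
    (fun c a b => by ext; simp [TensorProduct.smul_tmul', smul_smul, mul_comm])
    (fun a b b' => by ext; simp [add_mul, add_smul, TensorProduct.add_tmul])
    (fun c a b => by ext; simp [TensorProduct.smul_tmul', smul_smul]))

theorem contract_tmul (ℓ : Module.Dual k B) (a : A) (b : Bᵐᵒᵖ) (b' : B) (c : Cᵐᵒᵖ) :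
    contract ℓ (a ⊗ₜ b) (b' ⊗ₜ c) = ℓ (b.unop * b') • (a ⊗ₜ[k] c) := rfl

variable (ℓ : Module.Dual k B) (e : A ⊗[k] Bᵐᵒᵖ) (e' : B ⊗[k] Cᵐᵒᵖ)

theorem contract_balanced (b : B) :
    contract ℓ ((1 ⊗ₜ MulOpposite.op b) * e) e' = contract ℓ e ((b ⊗ₜ 1) * e') := by
  induction e using TensorProduct.induction_on with
  | zero => simp
  | add x y hx hy => rw [mul_add, map_add, map_add, LinearMap.add_apply, LinearMap.add_apply, hx, hy]
  | tmul x y =>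
    induction e' using TensorProduct.induction_on with
    | zero => simp
    | add x y hx hy => rw [mul_add, map_add, map_add, hx, hy]
    | tmul x' y' => simp [contract_tmul, mul_assoc]

theorem contract_mul_left (a : A) :
    contract ℓ ((a ⊗ₜ 1) * e) e' = (a ⊗ₜ 1) * contract ℓ e e' := by
  induction e using TensorProduct.induction_on with
  | zero => simp
  | add x y hx hy =>
    rw [mul_add, map_add, map_add, LinearMap.add_apply, LinearMap.add_apply, hx, hy, mul_add]
  | tmul x y =>
    induction e' using TensorProduct.induction_on with
    | zero => simp
    | add x y hx hy => rw [map_add, map_add, hx, hy, mul_add]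
    | tmul x' y' =>
      rw [Algebra.TensorProduct.tmul_mul_tmul, one_mul, contract_tmul, contract_tmul]
      refine Eq.trans ?_ (Algebra.mul_smul_comm _ _ _).symm
      rw [Algebra.TensorProduct.tmul_mul_tmul, one_mul]

theorem contract_mul_right (c : Cᵐᵒᵖ) :
    contract ℓ e ((1 ⊗ₜ c) * e') = (1 ⊗ₜ c) * contract ℓ e e' := by
  induction e using TensorProduct.induction_on with
  | zero => simp
  | add x y hx hy => rw [map_add, LinearMap.add_apply, LinearMap.add_apply, hx, hy, mul_add]
  | tmul x y =>
    induction e' using TensorProduct.induction_on with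
    | zero => simp
    | add x y hx hy => rw [mul_add, map_add, map_add, hx, hy, mul_add]
    | tmul x' y' =>
      rw [Algebra.TensorProduct.tmul_mul_tmul, one_mul, contract_tmul, contract_tmul]
      refine Eq.trans ?_ (Algebra.mul_smul_comm _ _ _).symm
      rw [Algebra.TensorProduct.tmul_mul_tmul, one_mul]

variable {N : Type*} [AddCommGroup N] [Module k N] [Module A N] [Module Bᵐᵒᵖ N]
  [IsScalarTower k A N] [IsScalarTower k Bᵐᵒᵖ N] [SMulCommClass A Bᵐᵒᵖ N]
  {M : Type*} [AddCommGroup M] [Module k M] [Module B M] [Module Cᵐᵒᵖ M]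
  [IsScalarTower k B M] [IsScalarTower k Cᵐᵒᵖ M] [SMulCommClass B Cᵐᵒᵖ M]

variable (k B N M) in
/-- The universal balanced map as a bilinear map. -/
noncomputable def tmulBilin : N →ₗ[k] M →ₗ[k] BalancedTensor k B N M :=
  (TensorProduct.mk k N M).compr₂ (balancedRel k B N M).mkQ

omit [Algebra k B] [IsScalarTower k Bᵐᵒᵖ N] [IsScalarTower k B M] in
theorem tmul_balanced (n : N) (b : B) (m : M) :
    tmulBilin k B N M (MulOpposite.op b • n) m = tmulBilin k B N M n (b • m) :=
  (Submodule.Quotient.eq _).2 (Submodule.subset_span ⟨n, b, m, rfl⟩)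

/-- The middle legs multiply to `b * b'`, whose expansion in the basis of `B` is reassembled by the
sum over `l`; balancedness then puts `b` back on `n`. It reflects that `(A ⊗ Bᵐᵒᵖ) ⊗_B (B ⊗ Cᵐᵒᵖ)`
is free over `A ⊗ Cᵐᵒᵖ` of rank `dim B`. -/
theorem sum_envAct_contract [FiniteDimensional k B] (n : N) (m : M) :
    ∑ l, envAct k A C (BalancedTensor k B N M) (contract ((Module.finBasis k B).coord l) e e')
        (tmulBilin k B N M n (Module.finBasis k B l • m)) =
      tmulBilin k B N M (envAct k A B N e n) (envAct k B C M e' m) := by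
  induction e using TensorProduct.induction_on with
  | zero => simp
  | add x y hx hy => simp only [map_add, LinearMap.add_apply, Finset.sum_add_distrib, hx, hy]
  | tmul a b =>
    induction e' using TensorProduct.induction_on with
    | zero => simp
    | add x y hx hy => simp only [map_add, LinearMap.add_apply, Finset.sum_add_distrib, hx, hy]
    | tmul b' c =>
      obtain ⟨b, rfl⟩ := MulOpposite.op_surjective b
      have h1 : ∀ l, envAct k A C (BalancedTensor k B N M)
          (contract ((Module.finBasis k B).coord l) (a ⊗ₜ MulOpposite.op b) (b' ⊗ₜ c))
            (tmulBilin k B N M n (Module.finBasis k B l • m)) =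
          tmulBilin k B N M (a • n)
            (((Module.finBasis k B).repr (b * b') l • Module.finBasis k B l) • (c • m)) := by
        intro l
        rw [contract_tmul, map_smul, LinearMap.smul_apply, envAct_tmul, smul_assoc,
          (tmulBilin k B N M (a • n)).map_smul, smul_comm (Module.finBasis k B l) c m]
        rfl
      rw [Finset.sum_congr rfl fun l _ => h1 l, ← map_sum, ← Finset.sum_smul,
        (Module.finBasis k B).sum_repr, envAct_tmul, envAct_tmul, smul_comm a, tmul_balanced,
        smul_smul]

omit [Algebra k B] [IsScalarTower k Bᵐᵒᵖ N] [IsScalarTower k B M] in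
theorem balancedTensor_ext {Z : Type*} [AddCommGroup Z] [Module k Z]
    {f g : BalancedTensor k B N M →ₗ[k] Z}
    (h : ∀ n m, f (tmulBilin k B N M n m) = g (tmulBilin k B N M n m)) : f = g :=
  Submodule.linearMap_qext _ (TensorProduct.ext' h)

variable {ι κ : Type*} [Fintype ι] [Fintype κ] (dN : DualBasis k A B N ι) (dM : DualBasis k B C M κ)

/-- The coordinates of `N ⊗_B M` obtained from those of `N` and `M` and a functional on `B`. -/
noncomputable def tensorCoord (i : ι) (j : κ) : BalancedTensor k B N M →ₗ[k] A ⊗[k] Cᵐᵒᵖ :=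
  (balancedRel k B N M).liftQ
    (TensorProduct.lift ((contract ℓ).compl₁₂ (dN.coord i) (dM.coord j))) (by
      refine Submodule.span_le.2 ?_
      rintro _ ⟨n, b, m, rfl⟩
      rw [SetLike.mem_coe, LinearMap.mem_ker, map_sub, sub_eq_zero, TensorProduct.lift.tmul,
        TensorProduct.lift.tmul, LinearMap.compl₁₂_apply, LinearMap.compl₁₂_apply,
        dN.coord_op_smul, dM.coord_smul, contract_balanced])

theorem tensorCoord_tmul (i : ι) (j : κ) (n : N) (m : M) :
    tensorCoord ℓ dN dM i j (tmulBilin k B N M n m) =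
      contract ℓ (dN.coord i n) (dM.coord j m) := rfl

theorem tensorCoord_smul (i : ι) (j : κ) (a : A) (p : BalancedTensor k B N M) :
    tensorCoord ℓ dN dM i j (a • p) = (a ⊗ₜ 1) * tensorCoord ℓ dN dM i j p := by
  have h : tensorCoord ℓ dN dM i j ∘ₗ leftHom k B N M A a =
      LinearMap.mulLeft k (a ⊗ₜ[k] (1 : Cᵐᵒᵖ)) ∘ₗ tensorCoord ℓ dN dM i j := by
    refine balancedTensor_ext fun n m => ?_
    change tensorCoord ℓ dN dM i j (tmulBilin k B N M (a • n) m) = _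
    rw [tensorCoord_tmul, dN.coord_smul, contract_mul_left]
    rfl
  exact LinearMap.congr_fun h p

theorem tensorCoord_op_smul (i : ι) (j : κ) (c : Cᵐᵒᵖ) (p : BalancedTensor k B N M) :
    tensorCoord ℓ dN dM i j (c • p) = (1 ⊗ₜ c) * tensorCoord ℓ dN dM i j p := by
  have h : tensorCoord ℓ dN dM i j ∘ₗ rightHom k B N M C c =
      LinearMap.mulLeft k ((1 : A) ⊗ₜ[k] c) ∘ₗ tensorCoord ℓ dN dM i j := by
    refine balancedTensor_ext fun n m => ?_
    change tensorCoord ℓ dN dM i j (tmulBilin k B N M n (c • m)) = _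
    rw [tensorCoord_tmul, dM.coord_op_smul, contract_mul_right]
    rfl
  exact LinearMap.congr_fun h p

/-- The dual basis of `N ⊗_B M` obtained from dual bases of `N` and `M`. -/
noncomputable def DualBasis.tensor [FiniteDimensional k B] :
    DualBasis k A C (BalancedTensor k B N M) ((ι × κ) × Fin (Module.finrank k B)) where
  vec t := tmulBilin k B N M (dN.vec t.1.1) (Module.finBasis k B t.2 • dM.vec t.1.2)
  coord t := tensorCoord ((Module.finBasis k B).coord t.2) dN dM t.1.1 t.1.2
  coord_smul _ := tensorCoord_smul _ dN dM _ _
  coord_op_smul _ := tensorCoord_op_smul _ dN dM _ _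
  sum_coord p := by
    have h : ∑ t : (ι × κ) × Fin (Module.finrank k B),
        (envAct k A C (BalancedTensor k B N M)).toLinearMap.flip
            (tmulBilin k B N M (dN.vec t.1.1) (Module.finBasis k B t.2 • dM.vec t.1.2)) ∘ₗ
          tensorCoord ((Module.finBasis k B).coord t.2) dN dM t.1.1 t.1.2 = LinearMap.id := by
      refine balancedTensor_ext fun n m => ?_
      simp only [LinearMap.sum_apply, LinearMap.comp_apply, LinearMap.flip_apply,
        AlgHom.toLinearMap_apply, tensorCoord_tmul, LinearMap.id_apply]
      rw [Fintype.sum_prod_type, Fintype.sum_prod_type]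
      simp only [sum_envAct_contract]
      simp only [← map_sum, dM.sum_coord, ← LinearMap.sum_apply, dN.sum_coord]
    have := LinearMap.congr_fun h p
    rw [LinearMap.sum_apply] at this
    exact this

end Tensor
end Bimod

/-! ### The main theorem -/

theorem mainTheorem9
    {k : Type u} [Field k] [PerfectField k]
    {A : Type v} [Ring A] [Algebra k A] [FiniteDimensional k A]
    {B : Type w} [Ring B] [Algebra k B] [FiniteDimensional k B]
    (hA : IsBasicAlgebra A) (hB : IsBasicAlgebra B)
    {M : Type x} [AddCommGroup M] [Module k M] [Module B M] [Module Aᵐᵒᵖ M]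
    [IsScalarTower k B M] [IsScalarTower k Aᵐᵒᵖ M] [SMulCommClass B Aᵐᵒᵖ M]
    (hM : IsFGProjectiveBimodule k B A M)
    {N : Type y} [AddCommGroup N] [Module k N] [Module A N] [Module Bᵐᵒᵖ N]
    [IsScalarTower k A N] [IsScalarTower k Bᵐᵒᵖ N] [SMulCommClass A Bᵐᵒᵖ N]
    (hN : IsFGProjectiveBimodule k A B N)
    (n : ℕ)
    (h : (Bimod.cyclicRep k A (Bimod.BalancedTensor k B N M) n).invariants = ⊥) :
    Subsingleton
      (Bimod.H0 k A (Bimod.TensorPow k A (Bimod.BalancedTensor k B N M) n)) := by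
  obtain ⟨_, ⟨dM⟩⟩ := Bimod.exists_dualBasis hM
  obtain ⟨_, ⟨dN⟩⟩ := Bimod.exists_dualBasis hN
  refine (dN.tensor dM).subsingleton_of_rotate fun x hx => ?_
  have hmem := Bimod.rotate_invariant hx
  rw [h] at hmem
  exact hmem
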